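/- Throughout, $(X,d)$ is a metric space; write $x\sim_s y$ if $d(x,y)\le s$, and for $A\subseteq X$ and $R\ge 0$ let $\mathcal N_R(A)=\{x\in X: x\sim_R a\text{ for some }a\in A\}$. Let $d_H$ be the Hausdorff distance. All functions called non-decreasing map $[0,\infty)$ to $[0,\infty)$ unless stated otherwise. **Coarse medians.** A ternary operator $\mu:X^3\to X$ is a *coarse median* on $(X,d)$ if - (C0) there is $\kappa_0>0$ such that $\mu(a_1,a_1,a_2)\sim_{\kappa_0}a_1$ and $\mu(a_{\sigma(1)},a_{\sigma(2)},a_{\sigma(3)})\sim_{\kappa_0}\mu(a_1,a_2,a_3)$ for all $a_1,a_2,a_3\in X$ and all permutations $\sigma$ of $\{1,2,3\}$; - (C1) there is a non-decreasing function $\rho$ with $d(\mu(a,b,c),\mu(a',b,c))\le\rho(d(a,a'))$ for all $a,a',b,c\in X$; - (C2) there is $\kappa_4>0$ such that $\mu(\mu(a,b,c),b,d)\sim_{\kappa_4}\mu(a,b,\mu(c,b,d))$ for all $a,b,c,d\in X$. A *median algebra* is a set $\Pi$ with a ternary operation $\langle\cdot,\cdot,\cdot\rangle$ that is invariant under permutations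 of its arguments and satisfies $\langle a,a,b\rangle=a$ and $\langle a,b,\langle c,d,e\rangle\rangle=\langle\langle a,b,c\rangle,\langle a,b,d\rangle,e\rangle$. It has rank at most $n$ if there is an injective median-preserving map $\{0,1\}^k\to\Pi$ (with coordinatewise majority vote on $\{0,1\}^k$) only for $k\le n$. A coarse median $\mu$ has *rank at most $n$* if there is a function $h:\mathbb N\to[0,\infty)$ such that for every $p\in\mathbb N$ and every $A\subseteq X$ with $1\le|A|\le p$ there are a finite median algebra $\Pi$ of rank at most $n$ and maps $\pi:A\to\Pi$, $\lambda:\Pi\to X$ with $$\lambda(\langle x,y,z\rangle)\sim_{h(p)}\mu(\lambda(x),\lambda(y),\lambda(z))\quad(x,y,z\in\Pi),\qquad a\sim_{h(p)}\lambda(\pi(a))\quad(a\in A).$$ **Coarse interval structures.** A map $\mathcal I=[\cdot,\cdot]:X^2\to\mathcal P(X)$ is a *coarse interval structure* on $(X,d)$, with constant $\kappa_0>0$, if - (I1)' $d_H([a,a],\{a\})\le\kappa_0$ and $d_H([a,b],[b,a])\le\kappa_0$ for all $a,b\in X$; - (I2)' there is a non-decreasing function $\phi$ such that, for all $R\ge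 0$, $a,b\in X$ and $c\in\mathcal N_R([a,b])$, we have $[a,c]\subseteq\mathcal N_{\phi(R)}([a,b])$; - (I3)' $\mathcal N_{\kappa_0}([a,b])\cap\mathcal N_{\kappa_0}([b,c])\cap\mathcal N_{\kappa_0}([c,a])\ne\emptyset$ for all $a,b,c\in X$, and there is a non-decreasing function $\psi:[\kappa_0,\infty)\to[0,\infty)$ with $\operatorname{diam}\big(\mathcal N_R([a,b])\cap\mathcal N_R([b,c])\cap\mathcal N_R([c,a])\big)\le\psi(R)$ for all $R\ge\kappa_0$ and $a,b,c\in X$. It has *rank at most $n$* if it satisfies the multi-median condition: there is a non-decreasing function $\psi$ such that for all $\lambda>0$ and $x_1,\dots,x_{n+1},q\in X$ $$\bigcap_{i\ne j}\mathcal N_\lambda([x_i,x_j])\subseteq\bigcup_{i=1}^{n+1}\mathcal N_{\psi(\lambda)}([x_i,q]),$$ where an intersection over no pairs is $X$. In both settings, *rank $n$* means that $n$ is the least natural number $m\ge0$ for which the rank is at most $m$. **Corollary.** Let $(X,d)$ be a metric space. 1. Let $\mu$ be a coarse median on $(X,d)$, and let $\mathcal I_\mu$ be given by $[a,b]=\{\mu(a,x,b):x\in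 X\}$. Then $\mathcal I_\mu$ is a coarse interval structure on $(X,d)$, and for every natural number $n\ge 0$, $\mu$ has rank at most $n$ if and only if $\mathcal I_\mu$ has rank at most $n$, and $\mu$ has rank $n$ if and only if $\mathcal I_\mu$ has rank $n$. 2. Let $\mathcal I$ be a coarse interval structure on $(X,d)$ with constant $\kappa_0$. Then there is a map $\mu:X^3\to X$ with $\mu(a,b,c)\in\mathcal N_{\kappa_0}([a,b])\cap\mathcal N_{\kappa_0}([b,c])\cap\mathcal N_{\kappa_0}([c,a])$ for all $a,b,c\in X$, and every such $\mu$ is a coarse median on $(X,d)$. For every such $\mu$ and every natural number $n\ge 0$, $\mathcal I$ has rank at most $n$ if and only if $\mu$ has rank at most $n$, and $\mathcal I$ has rank $n$ if and only if $\mu$ has rank $n$. -/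

import Mathlib

open scoped NNReal ENNReal

namespace CoarseMedian

/-! ### Median algebras and their rank -/

/-- `m` is a median operator: localisation, symmetry under all permutations of the arguments, and
the five point condition. -/
structure IsMedianAlgebra {P : Type*} (m : P → P → P → P) : Prop where
  localisation : ∀ a b : P, m a a b = a
  symmetry : ∀ (a : Fin 3 → P) (σ : Equiv.Perm (Fin 3)),
    m (a (σ 0)) (a (σ 1)) (a (σ 2)) = m (a 0) (a 1) (a 2)
  five_point : ∀ a b c d e : P, m a b (m c d e) = m (m a b c) (m a b d) e

/-- The median of the median `k`-cube `Fin k → Bool`: majority vote on each coordinate. -/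
def cubeMedian (k : ℕ) (u v w : Fin k → Bool) : Fin k → Bool :=
  fun i => (u i && v i) || (v i && w i) || (w i && u i)

/-- The median algebra `(P, m)` has rank at most `n`: every median cube that embeds in it (by an
injective map preserving medians) has dimension at most `n`. -/
def MedianAlgebraRankLE {P : Type*} (m : P → P → P → P) (n : ℕ) : Prop :=
  ∀ (k : ℕ) (f : (Fin k → Bool) → P), Function.Injective f →
    (∀ u v w, f (cubeMedian k u v w) = m (f u) (f v) (f w)) → k ≤ n

variable {X : Type*} [MetricSpace X]

/-! ### Coarse medians and their rank -/

/-- `μ` is a coarse median on the metric space `X`: coarse localisation and coarse symmetry,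
uniform bornologousness in the first variable, and the coarse four point condition. -/
structure IsCoarseMedian (μ : X → X → X → X) : Prop where
  localisation_symmetry : ∃ κ₀ : ℝ≥0, 0 < κ₀ ∧
    (∀ a b : X, dist (μ a a b) a ≤ κ₀) ∧
    ∀ (a : Fin 3 → X) (σ : Equiv.Perm (Fin 3)),
      dist (μ (a (σ 0)) (a (σ 1)) (a (σ 2))) (μ (a 0) (a 1) (a 2)) ≤ κ₀
  bornologous : ∃ ρ : ℝ≥0 → ℝ≥0, Monotone ρ ∧
    ∀ a a' b c : X, dist (μ a b c) (μ a' b c) ≤ ρ (nndist a a')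
  four_point : ∃ κ₄ : ℝ≥0, 0 < κ₄ ∧
    ∀ a b c d : X, dist (μ (μ a b c) b d) (μ a b (μ c b d)) ≤ κ₄

/-- The finite set `A ⊆ X` is approximated, up to the error `C`, by a finite median algebra
`(P, m)` of rank at most `n`. (Every finite median algebra is isomorphic to one in `Type`.) -/
def IsApproximable (μ : X → X → X → X) (n : ℕ) (C : ℝ≥0) (A : Finset X) : Prop :=
  ∃ (P : Type) (_ : Finite P) (m : P → P → P → P) (π : A → P) (l : P → X),
    IsMedianAlgebra m ∧ MedianAlgebraRankLE m n ∧
    (∀ x y z : P, dist (l (m x y z)) (μ (l x) (l y) (l z)) ≤ C) ∧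
    ∀ a : A, dist (a : X) (l (π a)) ≤ C

/-- The coarse median `μ` has rank at most `n`: there is `h : ℕ → [0, ∞)` such that each
nonempty set of at most `p` points is approximated up to the error `h p` by a finite median
algebra of rank at most `n`. -/
def MedianRankLE (μ : X → X → X → X) (n : ℕ) : Prop :=
  ∃ h : ℕ → ℝ≥0, ∀ (p : ℕ) (A : Finset X), A.Nonempty → A.card ≤ p →
    IsApproximable μ n (h p) A

/-- The coarse median `μ` has rank (exactly) `n`. -/
def MedianRankEq (μ : X → X → X → X) (n : ℕ) : Prop :=
  IsLeast {m : ℕ | MedianRankLE μ m} n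

/-! ### Coarse interval structures and their rank -/

/-- The `R`-neighbourhood of `A`: all points that are `R`-close to some point of `A`. -/
def nbhd (R : ℝ≥0) (A : Set X) : Set X := {x | ∃ a ∈ A, dist x a ≤ R}

/-- `I` is a coarse interval structure on `X` for which `κ₀` is an admissible constant. -/
structure IsCoarseIntervalStructureWith (I : X → X → Set X) (κ₀ : ℝ≥0) : Prop where
  pos : 0 < κ₀
  hausdorff_self : ∀ a : X, Metric.hausdorffEDist (I a a) {a} ≤ κ₀
  hausdorff_comm : ∀ a b : X, Metric.hausdorffEDist (I a b) (I b a) ≤ κ₀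
  interval_subset : ∃ φ : ℝ≥0 → ℝ≥0, Monotone φ ∧
    ∀ (R : ℝ≥0) (a b c : X), c ∈ nbhd R (I a b) → I a c ⊆ nbhd (φ R) (I a b)
  nonempty_inter : ∀ a b c : X,
    (nbhd κ₀ (I a b) ∩ nbhd κ₀ (I b c) ∩ nbhd κ₀ (I c a)).Nonempty
  diam_inter : ∃ ψ : ℝ≥0 → ℝ≥0, MonotoneOn ψ (Set.Ici κ₀) ∧
    ∀ R : ℝ≥0, κ₀ ≤ R → ∀ a b c : X,
      Metric.ediam (nbhd R (I a b) ∩ nbhd R (I b c) ∩ nbhd R (I c a)) ≤ ψ R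

/-- `I` is a coarse interval structure on `X`. -/
def IsCoarseIntervalStructure (I : X → X → Set X) : Prop :=
  ∃ κ₀ : ℝ≥0, IsCoarseIntervalStructureWith I κ₀

/-- The multi-median condition: the interval structure `I` has rank at most `n`. -/
def IntervalRankLE (I : X → X → Set X) (n : ℕ) : Prop :=
  ∃ ψ : ℝ≥0 → ℝ≥0, Monotone ψ ∧
    ∀ (lam : ℝ≥0), 0 < lam → ∀ (x : Fin (n + 1) → X) (q : X),
      (⋂ (i : Fin (n + 1)) (j : Fin (n + 1)) (_ : i ≠ j), nbhd lam (I (x i) (x j))) ⊆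
        ⋃ i : Fin (n + 1), nbhd (ψ lam) (I (x i) q)

/-- The interval structure `I` has rank (exactly) `n`. -/
def IntervalRankEq (I : X → X → Set X) (n : ℕ) : Prop :=
  IsLeast {m : ℕ | IntervalRankLE I m} n

/-! ### The two constructions -/

/-- The intervals `[a, b] = {μ(a, x, b) | x ∈ X}` induced by a ternary operator. -/
def inducedInterval (μ : X → X → X → X) (a b : X) : Set X :=
  Set.range fun x : X => μ a x b

/-- `μ` is an operator induced by the intervals `I` and the constant `κ₀`: it picks a point of the
intersection of the `κ₀`-neighbourhoods of `[a, b]`, `[b, c]` and `[c, a]`. -/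
def IsInducedMedian (I : X → X → Set X) (κ₀ : ℝ≥0) (μ : X → X → X → X) : Prop :=
  ∀ a b c : X, μ a b c ∈ nbhd κ₀ (I a b) ∩ nbhd κ₀ (I b c) ∩ nbhd κ₀ (I c a)

end CoarseMedian

namespace CoarseMedian

/-! Coarse axioms become exact after passing to families of points modulo bounded distance along a
filter (`CoarseLimit`). There a coarse median becomes a median algebra, and a coarse interval
structure becomes an interval operator with unique medians; by Sholander's theorem
(`IsIntervalMedian.isMedianAlgebra`, `isIntervalMedian_of_four_point`) these carry the same
information. Over the filter `⊤` on the type of all relevant tuples, an identity in the limit is a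
uniform bound, which converts each coarse structure into the other.

Ranks are compared along an ultrafilter on `ℕ`. If the intervals have rank at most `n`, the limit
algebra contains no `(n+1)`-cube (`medianAlgebraRankLE_limMedian`). If approximation failed for sets
of `p` points, a sequence of bad sets would give `p` points of the limit; they generate a finite
subalgebra (`finite_medianClosure`), and representatives of its elements approximate bad sets with
bounded error (`medianRankLE_of_limMedian`).

Conversely, let a sequence of configurations violate the multi-median condition. The product of
their approximating algebras maps homomorphically to the limit. A cube built in a distributive
lattice inside this product must collapse an edge in every factor, because the factors have rank at
most `n`; in the limit this puts `p` between some `x i` and `q`, a contradiction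
(`intervalRankLE_of_medianRankLE`). -/

/-! ### Interval operators with unique medians -/

/-- Sholander's axioms: `J` is an interval operator for which any three intervals
`J a b`, `J b c`, `J c a` meet in exactly the point `m a b c`. -/
structure IsIntervalMedian {P : Type*} (J : P → P → Set P) (m : P → P → P → P) : Prop where
  eq_of_mem_self : ∀ {a x : P}, x ∈ J a a → x = a
  comm : ∀ {a b x : P}, x ∈ J a b → x ∈ J b a
  trans : ∀ {a b c x : P}, c ∈ J a b → x ∈ J a c → x ∈ J a b
  mem : ∀ a b c : P, m a b c ∈ J a b ∧ m a b c ∈ J b c ∧ m a b c ∈ J c a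
  uniq : ∀ {a b c x : P}, x ∈ J a b → x ∈ J b c → x ∈ J c a → x = m a b c

namespace IsIntervalMedian

variable {P : Type*} {J : P → P → Set P} {m : P → P → P → P} (h : IsIntervalMedian J m)
include h

lemma swap (a b c : P) : m a b c = m b a c :=
  h.uniq (h.comm (h.mem a b c).1) (h.comm (h.mem a b c).2.2) (h.comm (h.mem a b c).2.1)

lemma rot (a b c : P) : m a b c = m b c a :=
  h.uniq (h.mem a b c).2.1 (h.mem a b c).2.2 (h.mem a b c).1

lemma mem₁ (a b c : P) : m a b c ∈ J a b := (h.mem a b c).1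

lemma mem₂ (a b c : P) : m a b c ∈ J b c := (h.mem a b c).2.1

lemma mem₃ (a b c : P) : m a b c ∈ J a c := h.comm (h.mem a b c).2.2

lemma left_mem (a b : P) : a ∈ J a b := by
  have h1 := h.eq_of_mem_self (h.mem₁ a a b)
  have h2 := h.mem₃ a a b
  rwa [h1] at h2

lemma right_mem (a b : P) : b ∈ J a b := h.comm (h.left_mem b a)

lemma self_left (a b : P) : m a a b = a := h.eq_of_mem_self (h.mem₁ a a b)

/-- The median of `x`, `y`, `b` lies in all three intervals of the triple `a`, `y`, `b`, and so does
`y`; uniqueness identifies the two. -/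
lemma between {a b x y : P} (hx : x ∈ J a y) (hy : y ∈ J a b) : y ∈ J x b := by
  have hw : m x y b ∈ J a y := h.comm (h.trans (h.comm hx) (h.comm (h.mem₁ x y b)))
  have hxb : x ∈ J b a := h.comm (h.trans hy hx)
  have hw' : m x y b ∈ J b a := h.trans hxb (h.comm (h.mem₃ x y b))
  have h1 := h.uniq hw (h.mem₂ x y b) hw'
  have h2 := h.uniq (h.right_mem a y) (h.left_mem y b) (h.comm hy)
  rw [h2, ← h1]
  exact h.mem₃ x y b

lemma antisymm {a x y : P} (hx : x ∈ J a y) (hy : y ∈ J a x) : x = y :=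
  (h.uniq hx (h.right_mem y x) (h.left_mem x a)).trans
    (h.uniq (h.right_mem a y) (h.left_mem y x) (h.comm hy)).symm

/-- `m a y z` is the greatest lower bound of `y` and `z` as seen from `a`. -/
lemma mem_median {a w y z : P} (hy : w ∈ J a y) (hz : w ∈ J a z) : w ∈ J a (m a y z) := by
  have h1 : m w y z ∈ J a y := h.comm (h.trans (h.comm hy) (h.comm (h.mem₁ w y z)))
  have h2 : m w y z ∈ J z a := h.trans (h.comm hz) (h.comm (h.mem₃ w y z))
  -- As `w` lies below both `y` and `z`, replacing `a` by `w` does not change the median.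
  have h3 := h.uniq h1 (h.mem₂ w y z) h2
  have h4 : m a y z ∈ J y w := h3 ▸ h.comm (h.mem₁ w y z)
  exact h.comm (h.between h4 (h.comm hy))

/-- Seen from `x`, the point `m x a z` is below both `a` and `y`, hence below `m x a y`. Reversing
the order puts `m x a y` between `m x a z` and `a`, so between `z` and `a`. -/
lemma median_mem_of_mem {a x y z : P} (hz : z ∈ J x y) : m a x y ∈ J a z := by
  have hp : m x a z ∈ J x (m x a y) :=
    h.mem_median (h.mem₁ x a z) (h.trans hz (h.mem₃ x a z))
  have h1 : m x a y ∈ J (m x a z) a := h.between hp (h.mem₁ x a y)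
  have h2 : m x a z ∈ J a z := h.mem₂ x a z
  rw [h.swap a x y]
  exact h.trans h2 (h.comm h1)

/-- Both sides are the meet of `a`, `c`, `d` in the order seen from `b`. -/
lemma median_assoc (a b c d : P) : m (m a b c) b d = m a b (m c b d) := by
  have e1 : m (m a b c) b d = m b (m b a c) d := by rw [h.swap _ b d, h.swap a b c]
  have e2 : m a b (m c b d) = m b a (m b c d) := by rw [h.swap a b, h.swap c b d]
  rw [e1, e2]
  apply h.antisymm (a := b)
  · have h0 : m b (m b a c) d ∈ J b (m b a c) := h.mem₁ _ _ _
    exact h.mem_median (h.trans (h.mem₁ b a c) h0)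
      (h.mem_median (h.trans (h.mem₃ b a c) h0) (h.mem₃ _ _ _))
  · have h0 : m b a (m b c d) ∈ J b (m b c d) := h.mem₃ _ _ _
    exact h.mem_median (h.mem_median (h.mem₁ _ _ _) (h.trans (h.mem₁ b c d) h0))
      (h.trans (h.mem₃ b c d) h0)

/-- Thus `m a b z` is the gate of `z` in `J a b`: the nearest point, passed on the way to every
other point of the interval. -/
lemma gate_mem {a b t : P} (z : P) (ht : t ∈ J a b) : m a b z ∈ J z t := by
  have := h.median_mem_of_mem (a := z) ht
  rwa [← h.rot z a b]

lemma convex {a b x y z : P} (hx : x ∈ J a b) (hy : y ∈ J a b) (hz : z ∈ J x y) : z ∈ J a b := by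
  have h1 := h.mem_median (h.gate_mem z hx) (h.gate_mem z hy)
  rw [← h.uniq (h.left_mem z x) hz (h.right_mem y z)] at h1
  rw [← h.eq_of_mem_self h1]
  exact h.mem₁ a b z

lemma median_gate {a b x y : P} (z : P) (hx : x ∈ J a b) (hy : y ∈ J a b) :
    m x y (m a b z) = m x y z :=
  h.uniq (h.mem₁ _ _ _)
    (h.trans (h.comm (h.gate_mem z hy)) (h.mem₂ x y (m a b z)))
    (h.comm (h.trans (h.comm (h.gate_mem z hx)) (h.mem₃ x y (m a b z))))

/-- The median `w` of the three gates lies between the gate of `z` and each of `c`, `d`, hence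
between that gate and `z`. But `w` is in `J a b`, so the gate also lies between `z` and `w`;
antisymmetry gives equality. -/
lemma gate_between (a b : P) {c d z : P} (hz : z ∈ J c d) :
    m a b z ∈ J (m a b c) (m a b d) := by
  have hg : ∀ t, m a b t ∈ J a b := h.mem₁ a b
  have h1 : m (m a b z) (m a b c) (m a b d) ∈ J (m a b z) c :=
    h.trans (h.comm (h.gate_mem c (hg z))) (h.mem₁ _ _ _)
  have h2 : m (m a b z) (m a b c) (m a b d) ∈ J (m a b z) d :=
    h.trans (h.comm (h.gate_mem d (hg z))) (h.mem₃ _ _ _)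
  have h3 := h.trans (h.median_mem_of_mem (a := m a b z) hz) (h.mem_median h1 h2)
  have h4 : m (m a b z) (m a b c) (m a b d) ∈ J a b :=
    h.convex (hg c) (hg d) (h.mem₂ _ _ _)
  have h5 : m (m a b z) (m a b c) (m a b d) = m a b z :=
    h.antisymm (h.comm h3) (h.gate_mem z h4)
  rw [← h5]
  exact h.mem₂ _ _ _

theorem isMedianAlgebra : IsMedianAlgebra m where
  localisation := h.self_left
  symmetry a σ := by
    have key : ∀ i j k : Fin 3, i ≠ j → j ≠ k → k ≠ i →
        m (a i) (a j) (a k) = m (a 0) (a 1) (a 2) := by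
      have e1 := h.swap (a 0) (a 1) (a 2)
      have e2 := h.rot (a 0) (a 1) (a 2)
      have e3 := h.rot (a 1) (a 2) (a 0)
      have e4 := h.rot (a 1) (a 0) (a 2)
      have e5 := h.rot (a 0) (a 2) (a 1)
      intro i j k hij hjk hki
      fin_cases i <;> fin_cases j <;> fin_cases k <;> simp_all
    exact key _ _ _ (by simp) (by simp) (by simp)
  five_point a b c d e := by
    have hg : ∀ t, m a b t ∈ J a b := h.mem₁ a b
    rw [← h.median_gate e (hg c) (hg d)]
    exact h.uniq (h.gate_between a b (h.mem₁ c d e)) (h.gate_between a b (h.mem₂ c d e))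
      (h.comm (h.gate_between a b (h.mem₃ c d e)))

end IsIntervalMedian

/-- The four point condition characterises medians. -/
theorem isIntervalMedian_of_four_point {P : Type*} {m : P → P → P → P}
    (loc : ∀ a b, m a a b = a) (swap : ∀ a b c, m a b c = m b a c)
    (rot : ∀ a b c, m a b c = m b c a)
    (assoc : ∀ a b c d, m (m a b c) b d = m a b (m c b d)) :
    IsIntervalMedian (fun a b => {x | m a x b = x}) m := by
  have swap' : ∀ a b c, m a b c = m a c b := fun a b c => by
    rw [rot a b c, swap b c a, ← rot a c b]
  have comm : ∀ {a b x}, m a x b = x → m b x a = x := fun {a b x} hx => by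
    rw [← swap, ← rot, hx]
  have trans : ∀ {a b c x}, m a c b = c → m a x c = x → m a x b = x := by
    intro a b c x hc hx
    have e := assoc x a c b
    rw [← swap a x c, hx, ← swap a c b, hc, ← swap a x c, hx, ← swap a x b] at e
    exact e
  have between : ∀ {a b x y}, m a x y = x → m a y b = y → m x y b = y := by
    intro a b x y hx hy
    have e := assoc b y a x
    rw [swap' a y x, hx, comm hy, loc] at e
    rw [rot x y b, swap y b x]
    exact e.symm
  have meet : ∀ {a b c x}, m a x b = x → m a x c = x → m a x (m a b c) = x := by
    intro a b c x hb hc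
    rw [swap a x, swap a b c, ← assoc, ← swap a x b, hb, ← swap a x c, hc]
  have absorb : ∀ a b c, m a (m a b c) b = m a b c := by
    intro a b c
    rw [swap, ← rot c a b, assoc, swap' b a b, loc]
  refine ⟨fun {a x} hx => ?_, comm, trans, fun a b c => ⟨?_, ?_, ?_⟩, fun {a b c x} h1 h2 h3 => ?_⟩
  · have hx' : m a x a = x := hx
    rw [← hx', swap', loc]
  · exact absorb a b c
  · show m b (m a b c) c = m a b c
    rw [rot a b c]
    exact absorb b c a
  · show m c (m a b c) a = m a b c
    rw [← rot c a b]
    exact absorb c a b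
  -- `x` lies below `m a b c` both from `a` and from `b`. Reversing the first relation puts `m a b
  -- c` between `x` and `b`, which together with the second forces equality.
  · have hx := meet h1 (comm h3)
    have hy := meet h2 (comm h1)
    rw [← rot a b c] at hy
    have hz := between hx (absorb a b c)
    exact hy.symm.trans ((swap' _ _ _).trans (comm hz))

/-! ### Median algebras -/

/-- The median subalgebra generated by the range of `a`. -/
inductive MedianClosure {P ι : Type*} (m : P → P → P → P) (a : ι → P) : P → Prop
  | of (i : ι) : MedianClosure m a (a i)
  | median {x y z : P} : MedianClosure m a x → MedianClosure m a y → MedianClosure m a z →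
      MedianClosure m a (m x y z)

lemma inf_sup_cyclic_le {L : Type*} [DistribLattice L] (u v w : L) :
    (u ⊔ v) ⊓ (v ⊔ w) ⊓ (w ⊔ u) ≤ u ⊓ v ⊔ v ⊓ w ⊔ w ⊓ u := by
  have h1 : (u ⊔ v) ⊓ (v ⊔ w) = v ⊔ u ⊓ w := by rw [sup_comm u v, ← sup_inf_left]
  rw [h1, inf_sup_right, inf_sup_left]
  refine sup_le (sup_le ?_ ?_) (inf_le_left.trans ?_)
  · exact le_sup_of_le_left le_sup_right
  · rw [inf_comm]; exact le_sup_of_le_left le_sup_left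
  · rw [inf_comm]; exact le_sup_right

namespace IsMedianAlgebra

variable {P : Type*} {m : P → P → P → P} (h : IsMedianAlgebra m)
include h

lemma swap (a b c : P) : m a b c = m b a c := by
  exact (h.symmetry ![a, b, c] (Equiv.swap 0 1)).symm

lemma swap' (a b c : P) : m a b c = m a c b := by
  exact (h.symmetry ![a, b, c] (Equiv.swap 1 2)).symm

lemma rot (a b c : P) : m a b c = m b c a := by rw [h.swap, h.swap']

lemma four_point (a b c d : P) : m (m a b c) b d = m a b (m c b d) := by
  have h1 : m (m a b c) b d = m b d (m b c a) := by rw [h.rot, h.rot a b c]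
  rw [h1, h.five_point, h.swap' b d b, h.localisation, h.swap' b _ a, h.swap b a, h.rot c b d]

theorem isIntervalMedian : IsIntervalMedian (fun a b => {x | m a x b = x}) m :=
  isIntervalMedian_of_four_point h.localisation h.swap h.rot h.four_point

/-- The map `m a b` is a homomorphism. -/
lemma median_median (a b c d e : P) :
    m a b (m c d e) = m (m a b c) (m a b d) (m a b e) := by
  rw [h.five_point]
  have hI := h.isIntervalMedian
  exact (hI.median_gate e (hI.mem₁ a b c) (hI.mem₁ a b d)).symm

/-- The interval from `a` to `b` is a distributive lattice with least element `a` and greatest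
element `b`. -/
abbrev distribLattice (a b : P) : DistribLattice {x // m a x b = x} :=
  have hI := h.isIntervalMedian
  have aa : ∀ x, m a x x = x := fun x => by rw [h.rot, h.localisation]
  let _ : Lattice {x // m a x b = x} :=
    { le := fun x y => m a x y = x
      le_refl := fun x => aa x
      le_trans := fun x y z hxy hyz => hI.trans (a := a) hyz hxy
      le_antisymm := fun x y hxy hyx => Subtype.ext (hI.antisymm (a := a) hxy hyx)
      inf := fun x y => ⟨m a x y, hI.trans (a := a) (c := x) x.2 (hI.mem₁ a x y)⟩
      sup := fun x y => ⟨m b x y,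
        hI.comm (a := b) (hI.trans (c := x) (hI.comm x.2) (hI.mem₁ b x y))⟩
      inf_le_left := fun x y => hI.mem₁ a x y
      inf_le_right := fun x y => hI.mem₃ a x y
      le_inf := fun x y z hy hz => hI.mem_median (a := a) hy hz
      le_sup_left := fun x y => by
        show m a x.1 (m b x y) = x
        rw [h.median_median, x.2, aa, h.localisation]
      le_sup_right := fun x y => by
        show m a y.1 (m b x y) = y
        rw [h.median_median, y.2, aa, h.swap', h.localisation]
      sup_le := fun x y z hx hy => by
        show m a (m b x y) z.1 = m b x y
        have hx' : m a x.1 z = x := hx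
        have hy' : m a y.1 z = y := hy
        rw [h.swap', h.median_median, z.2, h.swap' a z x, hx', h.swap' a z y, hy', h.rot, h.rot b]
        have := hI.median_gate (a := a) (b := z) b hx hy
        rwa [z.2] at this }
  DistribLattice.ofInfSupLe fun x y z => le_of_eq <| Subtype.ext <| by
    show m a x.1 (m b y z) = m b (m a x y) (m a x z)
    have := hI.median_gate (a := a) (b := x) b (hI.mem₁ a x y) (hI.mem₁ a x z)
    rw [h.median_median, x.2, h.rot, h.rot b, ← this, h.swap' a x b, h.swap' a b, x.2]

/-- A point between two others is squeezed between their meet and join. Hence the median lies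
between the join of the pairwise meets and the meet of the pairwise joins, which coincide by
distributivity. -/
lemma median_eq_sup (a b : P) : let _ := h.distribLattice a b
    ∀ u v w : {x // m a x b = x}, m u v w = ((u ⊓ v) ⊔ (v ⊓ w) ⊔ (w ⊓ u)).1 := by
  intro _ u v w
  have hI := h.isIntervalMedian
  let M : {x // m a x b = x} := ⟨m u v w, hI.convex (a := a) (b := b) u.2 v.2 (hI.mem₁ _ _ _)⟩
  have low : ∀ x y : {x // m a x b = x}, M.1 ∈ {z | m x.1 z y = z} → x ⊓ y ≤ M :=
    fun x y hM => hI.median_mem_of_mem (a := a) hM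
  have up : ∀ x y : {x // m a x b = x}, M.1 ∈ {z | m x.1 z y = z} → M ≤ x ⊔ y := by
    intro x y hM
    have h1 := hI.median_mem_of_mem (a := b) hM
    exact hI.comm (b := a) (hI.between h1 (hI.comm (a := a) (b := b) M.2))
  have h1 := hI.mem₁ u.1 v.1 w.1
  have h2 := hI.mem₂ u.1 v.1 w.1
  have h3 := hI.comm (hI.mem₃ u.1 v.1 w.1)
  have : M = (u ⊓ v) ⊔ (v ⊓ w) ⊔ (w ⊓ u) := le_antisymm
    ((le_inf (le_inf (up u v h1) (up v w h2)) (up w u h3)).trans (inf_sup_cyclic_le u v w))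
    (sup_le (sup_le (low u v h1) (low v w h2)) (low w u h3))
  exact congrArg Subtype.val this

/-! ### Finitely generated median algebras are finite -/

/-- The hypothesis extends from generators to all `w`, `z` in the closure because medians are
homomorphisms in each slot; then `w = x`, `z = y` gives `x = y`. -/
lemma eq_of_median_eq {ι : Type*} {a : ι → P} {x y : P} (hx : MedianClosure m a x)
    (hy : MedianClosure m a y) (hxy : ∀ i j, m (a i) (a j) x = m (a i) (a j) y) : x = y := by
  have h1 : ∀ i, ∀ z, MedianClosure m a z → m (a i) z x = m (a i) z y := by
    intro i z hz
    induction hz with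
    | of j => exact hxy i j
    | median _ _ _ ih₁ ih₂ ih₃ =>
      rw [h.swap' _ _ x, h.swap' _ _ y, h.median_median, h.median_median (a i) y]
      simp only [h.swap' (a i) x, h.swap' (a i) y, ih₁, ih₂, ih₃]
  have h2 : ∀ z, MedianClosure m a z → ∀ w, MedianClosure m a w → m w z x = m w z y := by
    intro z hz w hw
    induction hw with
    | of j => exact h1 j z hz
    | @median w₁ w₂ w₃ _ _ _ ih₁ ih₂ ih₃ =>
      have e : ∀ u t, m u z t = m z t u := fun u t => h.rot u z t
      rw [e, e, h.median_median, h.median_median z y]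
      simp only [← e, ih₁, ih₂, ih₃]
  have h3 := h2 y hy x hx
  rwa [h.swap', h.localisation, h.rot x y y, h.localisation] at h3

/-- Each coordinate `m (a i) (a j)` sends the closure into a finitely generated, hence finite,
distributive lattice, and by `eq_of_median_eq` the finitely many coordinates separate points. -/
theorem finite_medianClosure {ι : Type*} [Finite ι] (a : ι → P) :
    {x | MedianClosure m a x}.Finite := by
  have hI := h.isIntervalMedian
  have key : ∀ i j, (m (a i) (a j) '' {x | MedianClosure m a x}).Finite := by
    intro i j
    let _ := h.distribLattice (a i) (a j)
    let g : P → {x // m (a i) x (a j) = x} := fun x => ⟨m (a i) (a j) x, hI.mem₁ _ _ _⟩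
    have hfin : (latticeClosure (Set.range fun k => g (a k))).Finite :=
      (Set.finite_range _).latticeClosure
    refine (hfin.image Subtype.val).subset ?_
    rintro _ ⟨x, hx, rfl⟩
    refine ⟨g x, ?_, rfl⟩
    have hL := isSublattice_latticeClosure (s := Set.range fun k => g (a k))
    induction hx with
    | of k => exact subset_latticeClosure ⟨k, rfl⟩
    | @median x y z _ _ _ hx hy hz =>
      have : g (m x y z) = (g x ⊓ g y) ⊔ (g y ⊓ g z) ⊔ (g z ⊓ g x) := by
        refine Subtype.ext (Eq.trans ?_ (h.median_eq_sup _ _ (g x) (g y) (g z)))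
        exact h.median_median _ _ _ _ _
      rw [this]
      exact hL.supClosed (hL.supClosed (hL.infClosed hx hy) (hL.infClosed hy hz))
        (hL.infClosed hz hx)
  refine Set.Finite.of_finite_image (f := fun x (p : ι × ι) => m (a p.1) (a p.2) x) ?_ ?_
  · refine (Set.Finite.pi' (t := fun p : ι × ι => m (a p.1) (a p.2) '' {x | MedianClosure m a x})
      fun p => key p.1 p.2).subset ?_
    rintro _ ⟨x, hx, rfl⟩ p
    exact ⟨x, hx, rfl⟩
  · intro x hx y hy hxy
    exact h.eq_of_median_eq hx hy fun i j => congrFun hxy (i, j)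

end IsMedianAlgebra

/-! ### Cubes -/

/-- A median-preserving map from a cube that is not injective collapses an edge at the origin. -/
lemma exists_eq_of_not_injective {P : Type*} {m : P → P → P → P} {k : ℕ} {f : (Fin k → Bool) → P}
    (hf : ∀ u v w, f (cubeMedian k u v w) = m (f u) (f v) (f w)) (hinj : ¬ Function.Injective f) :
    ∃ i, f (Pi.single i true) = f fun _ => false := by
  simp only [Function.Injective, not_forall] at hinj
  obtain ⟨u, v, huv, hne⟩ := hinj
  obtain ⟨i, hi⟩ := Function.ne_iff.1 hne
  -- The median with the origin and its `i`-th neighbour keeps only coordinate `i`, so it moves the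
  -- collision of `u` and `v` to that edge.
  have key : ∀ u v : Fin k → Bool, f u = f v → u i = true → v i = false →
      f (Pi.single i true) = f fun _ => false := by
    intro u v huv hu hv
    have e1 : cubeMedian k (fun _ => false) (Pi.single i true) u = Pi.single i true := by
      ext j
      by_cases hj : j = i
      · subst hj; simp [cubeMedian, hu]
      · simp [cubeMedian, hj]
    have e2 : cubeMedian k (fun _ => false) (Pi.single i true) v = fun _ => false := by
      ext j
      by_cases hj : j = i
      · subst hj; simp [cubeMedian, hv]
      · simp [cubeMedian, hj]
    rw [← e1, hf, huv, ← hf, e2]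
  rcases hu : u i with _ | _ <;> rcases hv : v i with _ | _
  · simp [hu, hv] at hi
  · exact ⟨i, key v u huv.symm hv hu⟩
  · exact ⟨i, key u v huv hu hv⟩
  · simp [hu, hv] at hi

section Cube

variable {L : Type*} [DistribLattice L] [OrderBot L] {k : ℕ} (r : L) (e : Fin k → L)

/-- The map from the `k`-cube to a distributive lattice determined by the image `r` of the origin
and by elements `e i` such that `r ⊔ e i` are the images of its neighbours. -/
def cubeMap (v : Fin k → Bool) : L :=
  r ⊔ Finset.univ.sup fun i => if v i then e i else ⊥

lemma cubeMap_false : cubeMap r e (fun _ => false) = r := by simp [cubeMap]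

lemma cubeMap_single (i : Fin k) : cubeMap r e (Pi.single i true) = r ⊔ e i := by
  unfold cubeMap
  congr 1
  apply le_antisymm
  · refine Finset.sup_le fun j _ => ?_
    by_cases hj : j = i
    · subst hj; simp
    · simp [hj]
  · exact (by simp : e i ≤ if (Pi.single i true : Fin k → Bool) i then e i else ⊥).trans
      (Finset.le_sup (f := fun j => if (Pi.single i true : Fin k → Bool) j then e j else ⊥)
        (Finset.mem_univ i))

variable {r e}

lemma cubeMap_mono {u v : Fin k → Bool} (huv : ∀ i, u i = true → v i = true) :
    cubeMap r e u ≤ cubeMap r e v := by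
  refine sup_le_sup_left (Finset.sup_mono_fun fun i _ => ?_) r
  by_cases hu : u i
  · simp [hu, huv i hu]
  · simp [hu]

lemma cubeMap_le {v : Fin k → Bool} {x : L} (hr : r ≤ x) (hv : ∀ i, v i = true → e i ≤ x) :
    cubeMap r e v ≤ x := by
  refine sup_le hr (Finset.sup_le fun i _ => ?_)
  by_cases hi : v i
  · simpa [hi] using hv i hi
  · simp [hi]

lemma le_cubeMap {v : Fin k → Bool} {i : Fin k} (hi : v i = true) : e i ≤ cubeMap r e v := by
  have h1 := cubeMap_single r e i
  exact (le_sup_right.trans h1.ge).trans (cubeMap_mono fun j hj => by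
    by_cases hji : j = i
    · exact hji ▸ hi
    · simp [hji] at hj)

lemma cubeMap_or (u v : Fin k → Bool) :
    cubeMap r e (fun i => u i || v i) = cubeMap r e u ⊔ cubeMap r e v := by
  apply le_antisymm
  · refine cubeMap_le (le_sup_of_le_left le_sup_left) fun i hi => ?_
    rcases (Bool.or_eq_true _ _).mp hi with hi | hi
    · exact le_sup_of_le_left (le_cubeMap hi)
    · exact le_sup_of_le_right (le_cubeMap hi)
  · exact sup_le (cubeMap_mono fun i hi => by simp [hi]) (cubeMap_mono fun i hi => by simp [hi])

/-- Expanding by distributivity, the cross terms `e i ⊓ e j` are absorbed by `r`. -/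
lemma cubeMap_and (he : ∀ i j, i ≠ j → e i ⊓ e j ≤ r) (u v : Fin k → Bool) :
    cubeMap r e (fun i => u i && v i) = cubeMap r e u ⊓ cubeMap r e v := by
  apply le_antisymm
  · exact le_inf (cubeMap_mono fun i hi => by simp_all) (cubeMap_mono fun i hi => by simp_all)
  · unfold cubeMap
    rw [← sup_inf_left]
    refine sup_le le_sup_left ?_
    rw [Finset.sup_inf_distrib_right]
    refine Finset.sup_le fun i _ => ?_
    rw [Finset.sup_inf_distrib_left]
    refine Finset.sup_le fun j _ => ?_
    by_cases hi : u i
    swap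
    · simp [hi]
    by_cases hj : v j
    swap
    · simp [hj]
    simp only [hi, hj, if_true]
    by_cases hij : i = j
    · subst hij
      exact inf_le_left.trans (le_cubeMap (r := r) (v := fun i => u i && v i) (by simp [hi, hj]))
    · exact le_sup_of_le_left (he i j hij)

end Cube

open Filter

/-! ### Families of points up to bounded distance -/

section Limit

variable {T X : Type*} [MetricSpace X]

/-- Two families of points are identified if, along the filter `F`, their distance is bounded. -/
def boundedSetoid (F : Filter T) (X : Type*) [MetricSpace X] : Setoid (T → X) where
  r x y := ∃ C : ℝ≥0, ∀ᶠ t in F, dist (x t) (y t) ≤ C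
  iseqv :=
    { refl := fun x => ⟨0, by simp⟩
      symm := fun ⟨C, hC⟩ => ⟨C, by simpa only [dist_comm] using hC⟩
      trans := fun ⟨C, hC⟩ ⟨D, hD⟩ => ⟨C + D, by
        filter_upwards [hC, hD] with t h1 h2
        push_cast
        exact (dist_triangle _ _ _).trans (add_le_add h1 h2)⟩ }

/-- Families of points up to bounded distance along the filter `F`. -/
abbrev CoarseLimit (F : Filter T) (X : Type*) [MetricSpace X] : Type _ :=
  Quotient (boundedSetoid F X)

variable {F : Filter T}

/-- The class of a family of points. -/
abbrev CoarseLimit.mk (F : Filter T) (x : T → X) : CoarseLimit F X :=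
  Quotient.mk (boundedSetoid F X) x

lemma CoarseLimit.mk_eq_iff {x y : T → X} :
    CoarseLimit.mk F x = CoarseLimit.mk F y ↔ ∃ C : ℝ≥0, ∀ᶠ t in F, dist (x t) (y t) ≤ C :=
  Quotient.eq

lemma CoarseLimit.out_spec (x : T → X) :
    ∃ C : ℝ≥0, ∀ᶠ t in F, dist ((CoarseLimit.mk F x).out t) (x t) ≤ C :=
  CoarseLimit.mk_eq_iff.1 (Quotient.out_eq (CoarseLimit.mk F x))

/-- Along `⊤`, eventually means everywhere. With `T` the type of all tuples, exact identities thus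
turn into uniform estimates. -/
lemma exists_dist_le_of_mk_top_eq {x y : T → X}
    (hxy : CoarseLimit.mk ⊤ x = CoarseLimit.mk ⊤ y) : ∃ C : ℝ≥0, ∀ t, dist (x t) (y t) ≤ C := by
  simpa using CoarseLimit.mk_eq_iff.1 hxy

/-- Joint uniform bornologousness of a ternary operator. -/
def IsBornologous (μ : X → X → X → X) : Prop :=
  ∀ R : ℝ≥0, ∃ C : ℝ≥0, ∀ a a' b b' c c', dist a a' ≤ R → dist b b' ≤ R → dist c c' ≤ R →
    dist (μ a b c) (μ a' b' c') ≤ C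

/-- The operator induced by `μ` on families of points up to bounded distance. -/
noncomputable def limMedian (F : Filter T) (μ : X → X → X → X) (x y z : CoarseLimit F X) :
    CoarseLimit F X :=
  CoarseLimit.mk F fun t => μ (x.out t) (y.out t) (z.out t)

lemma IsBornologous.limMedian_mk {μ : X → X → X → X} (hμ : IsBornologous μ) (x y z : T → X) :
    limMedian F μ (CoarseLimit.mk F x) (CoarseLimit.mk F y) (CoarseLimit.mk F z) =
      CoarseLimit.mk F fun t => μ (x t) (y t) (z t) := by
  obtain ⟨A, hA⟩ := CoarseLimit.out_spec (F := F) x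
  obtain ⟨B, hB⟩ := CoarseLimit.out_spec (F := F) y
  obtain ⟨C, hC⟩ := CoarseLimit.out_spec (F := F) z
  obtain ⟨D, hD⟩ := hμ (A + B + C)
  refine CoarseLimit.mk_eq_iff.2 ⟨D, ?_⟩
  filter_upwards [hA, hB, hC] with t h1 h2 h3
  refine hD _ _ _ _ _ _ ?_ ?_ ?_ <;> push_cast <;>
    linarith [A.coe_nonneg, B.coe_nonneg, C.coe_nonneg]

end Limit

/-! ### Neighbourhoods and monotone bounds -/

variable {X : Type*} [MetricSpace X]

lemma nbhd_mono {R S : ℝ≥0} (hRS : R ≤ S) (A : Set X) : nbhd R A ⊆ nbhd S A :=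
  fun _ ⟨a, ha, h⟩ => ⟨a, ha, h.trans (by exact_mod_cast hRS)⟩

lemma mem_nbhd_of_dist_le {R S : ℝ≥0} {A : Set X} {x y : X} (hxy : dist x y ≤ S)
    (hy : y ∈ nbhd R A) : x ∈ nbhd (S + R) A := by
  obtain ⟨a, ha, h⟩ := hy
  refine ⟨a, ha, (dist_triangle _ y _).trans ?_⟩
  push_cast
  exact add_le_add hxy h

/-- A bound for each parameter can be chosen to depend monotonically on the parameter. -/
lemma exists_monotone_bound {Q : ℝ≥0 → ℝ≥0 → Prop} (hQ : ∀ R, ∃ C, Q R C)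
    (hanti : ∀ {R R' C}, R ≤ R' → Q R' C → Q R C) (hmono : ∀ {R C C'}, C ≤ C' → Q R C → Q R C') :
    ∃ φ : ℝ≥0 → ℝ≥0, Monotone φ ∧ ∀ R, Q R (φ R) := by
  choose C hC using hQ
  -- Summing the bounds at the integers up to `⌈R⌉₊` forces monotonicity.
  refine ⟨fun R => ∑ k ∈ Finset.range (⌈R⌉₊ + 1), C k, fun R S hRS => ?_, fun R => ?_⟩
  · exact Finset.sum_le_sum_of_subset
      (Finset.range_mono (Nat.succ_le_succ (Nat.ceil_mono hRS)))
  · exact hmono (Finset.single_le_sum (f := fun k : ℕ => C k) (fun _ _ => zero_le)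
      (Finset.self_mem_range_succ _)) (hanti (Nat.le_ceil R) (hC _))

/-! ### Coarse medians in the limit -/

namespace IsCoarseMedian

variable {μ : X → X → X → X} (h : IsCoarseMedian μ)
include h

lemma symmetry : ∃ κ : ℝ≥0, 0 < κ ∧ (∀ a b, dist (μ a a b) a ≤ κ) ∧
    (∀ a b c, dist (μ b a c) (μ a b c) ≤ κ) ∧ (∀ a b c, dist (μ a c b) (μ a b c) ≤ κ) ∧
    (∀ a b c, dist (μ c b a) (μ a b c) ≤ κ) ∧ (∀ a b c, dist (μ b c a) (μ a b c) ≤ κ) := by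
  obtain ⟨κ, hκ, h1, h2⟩ := h.localisation_symmetry
  exact ⟨κ, hκ, h1, fun a b c => h2 ![a, b, c] (Equiv.swap 0 1),
    fun a b c => h2 ![a, b, c] (Equiv.swap 1 2), fun a b c => h2 ![a, b, c] (Equiv.swap 0 2),
    fun a b c => h2 ![a, b, c] (finRotate 3)⟩

lemma isBornologous : IsBornologous μ := by
  obtain ⟨κ, -, -, h1, -, h2, -⟩ := h.symmetry
  obtain ⟨ρ, hρ, hb⟩ := h.bornologous
  intro R
  -- Three changes of the first argument, and four permutations to bring each argument there and
  -- back.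
  refine ⟨3 * ρ R + 4 * κ, fun a a' b b' c c' ha hb' hc => ?_⟩
  have key : ∀ {x x'} y z, dist x x' ≤ R → dist (μ x y z) (μ x' y z) ≤ ρ R :=
    fun y z hx => (hb _ _ _ _).trans (by exact_mod_cast hρ (by exact_mod_cast hx))
  have e1 := key b c ha
  have e2 : dist (μ b a' c) (μ b' a' c) ≤ ρ R := key a' c hb'
  have e3 : dist (μ c b' a') (μ c' b' a') ≤ ρ R := key b' a' hc
  have f1 : dist (μ a' b c) (μ b a' c) ≤ κ := h1 b a' c
  have f2 : dist (μ b' a' c) (μ a' b' c) ≤ κ := h1 a' b' c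
  have f3 : dist (μ a' b' c) (μ c b' a') ≤ κ := h2 c b' a'
  have f4 : dist (μ c' b' a') (μ a' b' c') ≤ κ := h2 a' b' c'
  push_cast
  linarith [dist_triangle (μ a b c) (μ a' b c) (μ a' b' c'),
    dist_triangle (μ a' b c) (μ b a' c) (μ a' b' c'),
    dist_triangle (μ b a' c) (μ b' a' c) (μ a' b' c'),
    dist_triangle (μ b' a' c) (μ a' b' c) (μ a' b' c'),
    dist_triangle (μ a' b' c) (μ c b' a') (μ a' b' c'),
    dist_triangle (μ c b' a') (μ c' b' a') (μ a' b' c')]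

theorem isIntervalMedian {T : Type*} (F : Filter T) :
    IsIntervalMedian (fun a b => {x | limMedian F μ a x b = x}) (limMedian F μ) := by
  have hb := h.isBornologous
  obtain ⟨κ, -, h1, h2, -, -, h3⟩ := h.symmetry
  obtain ⟨κ', -, h4⟩ := h.four_point
  apply isIntervalMedian_of_four_point
  · intro a b
    induction a using Quotient.inductionOn with | _ a
    induction b using Quotient.inductionOn with | _ b
    rw [hb.limMedian_mk]
    exact CoarseLimit.mk_eq_iff.2 ⟨κ, Eventually.of_forall fun t => h1 _ _⟩
  · intro a b c
    induction a using Quotient.inductionOn with | _ a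
    induction b using Quotient.inductionOn with | _ b
    induction c using Quotient.inductionOn with | _ c
    rw [hb.limMedian_mk, hb.limMedian_mk]
    exact CoarseLimit.mk_eq_iff.2 ⟨κ, Eventually.of_forall fun t => h2 _ _ _⟩
  · intro a b c
    induction a using Quotient.inductionOn with | _ a
    induction b using Quotient.inductionOn with | _ b
    induction c using Quotient.inductionOn with | _ c
    rw [hb.limMedian_mk, hb.limMedian_mk, eq_comm]
    exact CoarseLimit.mk_eq_iff.2 ⟨κ, Eventually.of_forall fun t => h3 _ _ _⟩
  · intro a b c d
    induction a using Quotient.inductionOn with | _ a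
    induction b using Quotient.inductionOn with | _ b
    induction c using Quotient.inductionOn with | _ c
    induction d using Quotient.inductionOn with | _ d
    simp only [hb.limMedian_mk]
    exact CoarseLimit.mk_eq_iff.2 ⟨κ', Eventually.of_forall fun t => h4 _ _ _ _⟩

theorem isMedianAlgebra {T : Type*} (F : Filter T) : IsMedianAlgebra (limMedian F μ) :=
  (h.isIntervalMedian F).isMedianAlgebra

/-- Points near the interval induced by a coarse median are fixed by the median, in the limit. -/
lemma limMedian_eq_of_mem_nbhd {T : Type*} {F : Filter T} {R : ℝ≥0} {a b x : T → X}
    (hx : ∀ᶠ t in F, x t ∈ nbhd R (inducedInterval μ (a t) (b t))) :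
    limMedian F μ (CoarseLimit.mk F a) (CoarseLimit.mk F x) (CoarseLimit.mk F b) =
      CoarseLimit.mk F x := by
  have : ∀ t, ∃ z, x t ∈ nbhd R (inducedInterval μ (a t) (b t)) →
      dist (x t) (μ (a t) z (b t)) ≤ R := by
    intro t
    by_cases ht : x t ∈ nbhd R (inducedInterval μ (a t) (b t))
    · obtain ⟨_, ⟨z, rfl⟩, hz⟩ := ht
      exact ⟨z, fun _ => hz⟩
    · exact ⟨x t, fun h => absurd h ht⟩
  choose z hz using this
  have e : CoarseLimit.mk F x =
      limMedian F μ (CoarseLimit.mk F a) (CoarseLimit.mk F z) (CoarseLimit.mk F b) := by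
    rw [h.isBornologous.limMedian_mk]
    exact CoarseLimit.mk_eq_iff.2 ⟨R, hx.mono fun t ht => hz t ht⟩
  rw [e]
  exact (h.isIntervalMedian F).mem₃ _ _ _

/-- The conditions on `φ` and `ψ` are transitivity of intervals and uniqueness of medians in the
limit; the other conditions follow directly from coarse symmetry and localisation. -/
theorem isCoarseIntervalStructure : IsCoarseIntervalStructure (inducedInterval μ) := by
  have hb := h.isBornologous
  obtain ⟨κ, hκ, h1, h2, h3, h4, -⟩ := h.symmetry
  have hκ2 : κ ≤ 2 * κ := by rw [two_mul]; exact le_self_add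
  have toE : ∀ {x y : X} {C : ℝ≥0}, dist x y ≤ C → edist x y ≤ C := fun {x y C} hxy => by
    rw [edist_nndist]; exact_mod_cast hxy
  refine ⟨2 * κ, by positivity, fun a => ?_, fun a b => ?_, ?_, fun a b c => ?_, ?_⟩
  · have e : ∀ x, edist (μ a x a) a ≤ (2 * κ : ℝ≥0) := fun x => toE <| by
      have := dist_triangle (μ a x a) (μ a a x) a
      push_cast
      linarith [h1 a x, h3 a a x]
    refine Metric.hausdorffEDist_le_of_mem_edist ?_ ?_
    · rintro _ ⟨x, rfl⟩
      exact ⟨a, rfl, e x⟩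
    · rintro _ rfl
      exact ⟨_, ⟨_, rfl⟩, by rw [edist_comm]; exact e (by assumption)⟩
  · have e : ∀ a b x, edist (μ a x b) (μ b x a) ≤ (2 * κ : ℝ≥0) := fun a b x =>
      toE ((h4 b x a).trans (by exact_mod_cast hκ2))
    refine Metric.hausdorffEDist_le_of_mem_edist ?_ ?_
    · rintro _ ⟨x, rfl⟩
      exact ⟨_, ⟨x, rfl⟩, e a b x⟩
    · rintro _ ⟨x, rfl⟩
      exact ⟨_, ⟨x, rfl⟩, e b a x⟩
  · have := exists_monotone_bound (Q := fun R C => ∀ (a b c : X),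
      c ∈ nbhd R (inducedInterval μ a b) → inducedInterval μ a c ⊆ nbhd C (inducedInterval μ a b))
      (fun R => ?_) (fun hR hC a b c hc => hC a b c (nbhd_mono hR _ hc))
      (fun hC hR a b c hc => (hR a b c hc).trans (nbhd_mono hC _))
    · obtain ⟨φ, hφ, H⟩ := this
      exact ⟨φ, hφ, fun R => H R⟩
    -- Indexing by all configurations that satisfy the hypothesis for this `R` makes one identity in
    -- the limit yield one constant for all of them.
    let T := {t : X × X × X × X // t.2.2.1 ∈ nbhd R (inducedInterval μ t.1 t.2.1)}
    let a : T → X := fun t => t.1.1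
    let b : T → X := fun t => t.1.2.1
    let c : T → X := fun t => t.1.2.2.1
    let x : T → X := fun t => t.1.2.2.2
    have hI := h.isIntervalMedian (⊤ : Filter T)
    have e1 := h.limMedian_eq_of_mem_nbhd (F := (⊤ : Filter T)) (R := R) (a := a) (b := b) (x := c)
      (Eventually.of_forall fun t => t.2)
    have e2 := hI.trans (a := CoarseLimit.mk ⊤ a) e1 (hI.mem₃ _ (CoarseLimit.mk ⊤ x) _)
    simp only [Set.mem_ofPred_eq, hb.limMedian_mk] at e2
    obtain ⟨C, hC⟩ := exists_dist_le_of_mk_top_eq e2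
    refine ⟨C, ?_⟩
    rintro a b c hc _ ⟨x, rfl⟩
    refine ⟨_, ⟨μ a x c, rfl⟩, ?_⟩
    rw [dist_comm]
    exact hC ⟨(a, b, c, x), hc⟩
  · refine ⟨μ a b c, ⟨?_, ?_⟩, ?_⟩
    · exact ⟨_, ⟨c, rfl⟩, (h3 a c b).trans (by exact_mod_cast hκ2)⟩
    · exact ⟨_, ⟨a, rfl⟩, (h2 b a c).trans (by exact_mod_cast hκ2)⟩
    · exact ⟨_, ⟨b, rfl⟩, (h4 c b a).trans (by exact_mod_cast hκ2)⟩
  · have := exists_monotone_bound (Q := fun R C => ∀ (a b c : X),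
      Metric.ediam (nbhd R (inducedInterval μ a b) ∩ nbhd R (inducedInterval μ b c) ∩
        nbhd R (inducedInterval μ c a)) ≤ C)
      (fun R => ?_) (fun hR hC a b c => (Metric.ediam_mono (Set.inter_subset_inter
        (Set.inter_subset_inter (nbhd_mono hR _) (nbhd_mono hR _)) (nbhd_mono hR _))).trans
          (hC a b c))
      (fun hC hR a b c => (hR a b c).trans (by exact_mod_cast hC))
    · obtain ⟨φ, hφ, H⟩ := this
      exact ⟨φ, hφ.monotoneOn _, fun R _ => H R⟩
    let T := {t : X × X × X × X // t.2.2.2 ∈ nbhd R (inducedInterval μ t.1 t.2.1) ∩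
      nbhd R (inducedInterval μ t.2.1 t.2.2.1) ∩ nbhd R (inducedInterval μ t.2.2.1 t.1)}
    let a : T → X := fun t => t.1.1
    let b : T → X := fun t => t.1.2.1
    let c : T → X := fun t => t.1.2.2.1
    let x : T → X := fun t => t.1.2.2.2
    have e1 := h.limMedian_eq_of_mem_nbhd (F := (⊤ : Filter T)) (R := R) (a := a) (b := b) (x := x)
      (Eventually.of_forall fun t => t.2.1.1)
    have e2 := h.limMedian_eq_of_mem_nbhd (F := (⊤ : Filter T)) (R := R) (a := b) (b := c) (x := x)
      (Eventually.of_forall fun t => t.2.1.2)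
    have e3 := h.limMedian_eq_of_mem_nbhd (F := (⊤ : Filter T)) (R := R) (a := c) (b := a) (x := x)
      (Eventually.of_forall fun t => t.2.2)
    have e := (h.isIntervalMedian (⊤ : Filter T)).uniq e1 e2 e3
    rw [hb.limMedian_mk] at e
    obtain ⟨C, hC⟩ := exists_dist_le_of_mk_top_eq e
    refine ⟨C + C, fun a b c => Metric.ediam_le fun x hx y hy => ?_⟩
    have h1 := hC ⟨(a, b, c, x), hx⟩
    have h2 := hC ⟨(a, b, c, y), hy⟩
    rw [dist_comm] at h2
    refine toE ((dist_triangle _ (μ a b c) _).trans ?_)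
    push_cast
    exact add_le_add h1 h2

end IsCoarseMedian

/-! ### Coarse interval structures in the limit -/

namespace IsCoarseIntervalStructureWith

variable {I : X → X → Set X} {κ₀ : ℝ≥0} (h : IsCoarseIntervalStructureWith I κ₀)
include h

lemma dist_of_mem_self {a x : X} {R : ℝ≥0} (hx : x ∈ nbhd R (I a a)) :
    dist x a ≤ (R + (κ₀ + 1) : ℝ≥0) := by
  obtain ⟨y, hy, hxy⟩ := hx
  -- The Hausdorff infimum need not be attained; the extra `1` leaves room to choose a point.
  obtain ⟨z, rfl, hz⟩ := Metric.exists_edist_lt_of_hausdorffEDist_lt (r := (κ₀ + 1 : ℝ≥0)) hy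
    ((h.hausdorff_self a).trans_lt (by exact_mod_cast lt_add_one κ₀))
  have hz' : dist y z ≤ (κ₀ + 1 : ℝ≥0) := by
    rw [edist_nndist] at hz
    exact_mod_cast hz.le
  rw [NNReal.coe_add]
  exact (dist_triangle _ y _).trans (add_le_add hxy hz')

lemma mem_nbhd_comm {a b x : X} {R : ℝ≥0} (hx : x ∈ nbhd R (I a b)) :
    x ∈ nbhd (R + (κ₀ + 1)) (I b a) := by
  obtain ⟨y, hy, hxy⟩ := hx
  obtain ⟨z, hzI, hz⟩ := Metric.exists_edist_lt_of_hausdorffEDist_lt (r := (κ₀ + 1 : ℝ≥0)) hy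
    ((h.hausdorff_comm a b).trans_lt (by exact_mod_cast lt_add_one κ₀))
  have hz' : dist y z ≤ (κ₀ + 1 : ℝ≥0) := by
    rw [edist_nndist] at hz
    exact_mod_cast hz.le
  refine ⟨z, hzI, ?_⟩
  rw [NNReal.coe_add]
  exact (dist_triangle _ y _).trans (add_le_add hxy hz')

lemma left_mem : ∃ C : ℝ≥0, ∀ a b, a ∈ nbhd C (I a b) := by
  refine ⟨κ₀ + (κ₀ + 1) + κ₀, fun a b => ?_⟩
  obtain ⟨z, ⟨hz1, hz2⟩, -⟩ := h.nonempty_inter a a b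
  exact mem_nbhd_of_dist_le ((dist_comm _ _).trans_le (h.dist_of_mem_self hz1)) hz2

lemma right_mem : ∃ C : ℝ≥0, ∀ a b, b ∈ nbhd C (I a b) := by
  obtain ⟨C, hC⟩ := h.left_mem
  exact ⟨_, fun a b => h.mem_nbhd_comm (hC b a)⟩

lemma mem_nbhd_trans : ∀ R S : ℝ≥0, ∃ C : ℝ≥0, ∀ a b c x, c ∈ nbhd R (I a b) → x ∈ nbhd S (I a c) →
    x ∈ nbhd C (I a b) := by
  obtain ⟨φ, -, hφ⟩ := h.interval_subset
  intro R S
  refine ⟨S + φ R, fun a b c x hc hx => ?_⟩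
  obtain ⟨y, hy, hxy⟩ := hx
  exact mem_nbhd_of_dist_le hxy (hφ R a b c hc hy)

lemma exists_dist_le (R : ℝ≥0) : ∃ C : ℝ≥0, ∀ a b c x y,
    x ∈ nbhd R (I a b) → x ∈ nbhd R (I b c) → x ∈ nbhd R (I c a) →
    y ∈ nbhd R (I a b) → y ∈ nbhd R (I b c) → y ∈ nbhd R (I c a) → dist x y ≤ C := by
  obtain ⟨ψ, -, hψ⟩ := h.diam_inter
  refine ⟨ψ (max R κ₀), fun a b c x y h1 h2 h3 h4 h5 h6 => ?_⟩
  have mono := fun a b => nbhd_mono (le_max_left R κ₀) (I a b)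
  have := (Metric.edist_le_ediam_of_mem (s := nbhd (max R κ₀) (I a b) ∩ nbhd (max R κ₀) (I b c) ∩
    nbhd (max R κ₀) (I c a)) ⟨⟨mono _ _ h1, mono _ _ h2⟩, mono _ _ h3⟩
    ⟨⟨mono _ _ h4, mono _ _ h5⟩, mono _ _ h6⟩).trans (hψ _ (le_max_right R κ₀) a b c)
  rw [edist_nndist] at this
  exact_mod_cast this

/-- Being close to `b'`, the point `b` is near `I a b'`, so transitivity moves the second endpoint;
coarse symmetry reduces the first endpoint to this case. -/
lemma mem_nbhd_congr (R S : ℝ≥0) : ∃ C : ℝ≥0, ∀ a a' b b' x, dist a a' ≤ R → dist b b' ≤ R →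
    x ∈ nbhd S (I a b) → x ∈ nbhd C (I a' b') := by
  obtain ⟨D, hD⟩ := h.right_mem
  have key : ∀ S : ℝ≥0, ∃ C : ℝ≥0, ∀ a b b' x, dist b b' ≤ R → x ∈ nbhd S (I a b) →
      x ∈ nbhd C (I a b') := by
    intro S
    obtain ⟨C, hC⟩ := h.mem_nbhd_trans (R + D) S
    exact ⟨C, fun a b b' x hb hx => hC a b' b x (mem_nbhd_of_dist_le hb (hD a b')) hx⟩
  obtain ⟨C₁, h1⟩ := key S
  obtain ⟨C₂, h2⟩ := key (C₁ + (κ₀ + 1))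
  exact ⟨C₂ + (κ₀ + 1), fun a a' b b' x ha hb hx =>
    h.mem_nbhd_comm (h2 _ _ _ _ ha (h.mem_nbhd_comm (h1 _ _ _ _ hb hx)))⟩

lemma isBornologous {μ : X → X → X → X} (hμ : IsInducedMedian I κ₀ μ) : IsBornologous μ := by
  intro R
  obtain ⟨C, hC⟩ := h.mem_nbhd_congr R κ₀
  obtain ⟨D, hD⟩ := h.exists_dist_le (max κ₀ C)
  refine ⟨D, fun a a' b b' c c' ha hb hc => ?_⟩
  rw [dist_comm] at ha hb hc
  obtain ⟨⟨h1, h2⟩, h3⟩ := hμ a b c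
  obtain ⟨⟨h4, h5⟩, h6⟩ := hμ a' b' c'
  have l := fun a b => nbhd_mono (le_max_left κ₀ C) (I a b)
  have r := fun a b => nbhd_mono (le_max_right κ₀ C) (I a b)
  exact hD a b c _ _ (l _ _ h1) (l _ _ h2) (l _ _ h3) (r _ _ (hC _ _ _ _ _ ha hb h4))
    (r _ _ (hC _ _ _ _ _ hb hc h5)) (r _ _ (hC _ _ _ _ _ hc ha h6))

end IsCoarseIntervalStructureWith

/-- The interval operator on families of points up to bounded distance induced by `I`. -/
def limInterval {T : Type*} (F : Filter T) (I : X → X → Set X) (a b : CoarseLimit F X) :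
    Set (CoarseLimit F X) :=
  {x | ∃ R : ℝ≥0, ∀ᶠ t in F, x.out t ∈ nbhd R (I (a.out t) (b.out t))}

namespace IsCoarseIntervalStructureWith

variable {I : X → X → Set X} {κ₀ : ℝ≥0} (h : IsCoarseIntervalStructureWith I κ₀)
include h

lemma mk_mem_limInterval {T : Type*} {F : Filter T} {a b x : T → X} :
    CoarseLimit.mk F x ∈ limInterval F I (CoarseLimit.mk F a) (CoarseLimit.mk F b) ↔
      ∃ R : ℝ≥0, ∀ᶠ t in F, x t ∈ nbhd R (I (a t) (b t)) := by
  have key : ∀ {a a' b b' x x' : T → X}, (∃ C : ℝ≥0, ∀ᶠ t in F, dist (a t) (a' t) ≤ C) →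
      (∃ C : ℝ≥0, ∀ᶠ t in F, dist (b t) (b' t) ≤ C) →
      (∃ C : ℝ≥0, ∀ᶠ t in F, dist (x' t) (x t) ≤ C) →
      (∃ R : ℝ≥0, ∀ᶠ t in F, x t ∈ nbhd R (I (a t) (b t))) →
      ∃ R : ℝ≥0, ∀ᶠ t in F, x' t ∈ nbhd R (I (a' t) (b' t)) := by
    rintro a a' b b' x x' ⟨A, hA⟩ ⟨B, hB⟩ ⟨C, hC⟩ ⟨R, hR⟩
    obtain ⟨D, hD⟩ := h.mem_nbhd_congr (A + B) R
    refine ⟨C + D, ?_⟩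
    filter_upwards [hA, hB, hC, hR] with t h1 h2 h3 h4
    refine mem_nbhd_of_dist_le h3 (hD _ _ _ _ _ ?_ ?_ h4) <;> push_cast <;>
      linarith [A.coe_nonneg, B.coe_nonneg]
  have out := fun x : T → X => CoarseLimit.out_spec (F := F) x
  have out' : ∀ x : T → X, ∃ C : ℝ≥0, ∀ᶠ t in F, dist (x t) ((CoarseLimit.mk F x).out t) ≤ C :=
    fun x => by simpa only [dist_comm] using out x
  exact ⟨key (out a) (out b) (out' x), key (out' a) (out' b) (out x)⟩

theorem isIntervalMedian {μ : X → X → X → X} (hμ : IsInducedMedian I κ₀ μ) {T : Type*}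
    (F : Filter T) : IsIntervalMedian (limInterval F I) (limMedian F μ) where
  eq_of_mem_self {a x} hx := by
    induction a using Quotient.inductionOn with | _ a
    induction x using Quotient.inductionOn with | _ x
    obtain ⟨R, hR⟩ := h.mk_mem_limInterval.1 hx
    exact CoarseLimit.mk_eq_iff.2 ⟨_, hR.mono fun t ht => h.dist_of_mem_self ht⟩
  comm {a b x} hx := by
    induction a using Quotient.inductionOn with | _ a
    induction b using Quotient.inductionOn with | _ b
    induction x using Quotient.inductionOn with | _ x
    obtain ⟨R, hR⟩ := h.mk_mem_limInterval.1 hx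
    exact h.mk_mem_limInterval.2 ⟨_, hR.mono fun t ht => h.mem_nbhd_comm ht⟩
  trans {a b c x} hc hx := by
    induction a using Quotient.inductionOn with | _ a
    induction b using Quotient.inductionOn with | _ b
    induction c using Quotient.inductionOn with | _ c
    induction x using Quotient.inductionOn with | _ x
    obtain ⟨R, hR⟩ := h.mk_mem_limInterval.1 hc
    obtain ⟨S, hS⟩ := h.mk_mem_limInterval.1 hx
    obtain ⟨C, hC⟩ := h.mem_nbhd_trans R S
    refine h.mk_mem_limInterval.2 ⟨C, ?_⟩
    filter_upwards [hR, hS] with t h1 h2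
    exact hC _ _ _ _ h1 h2
  mem a b c := by
    induction a using Quotient.inductionOn with | _ a
    induction b using Quotient.inductionOn with | _ b
    induction c using Quotient.inductionOn with | _ c
    rw [(h.isBornologous hμ).limMedian_mk]
    exact ⟨h.mk_mem_limInterval.2 ⟨κ₀, .of_forall fun t => (hμ _ _ _).1.1⟩,
      h.mk_mem_limInterval.2 ⟨κ₀, .of_forall fun t => (hμ _ _ _).1.2⟩,
      h.mk_mem_limInterval.2 ⟨κ₀, .of_forall fun t => (hμ _ _ _).2⟩⟩
  uniq {a b c x} h1 h2 h3 := by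
    induction a using Quotient.inductionOn with | _ a
    induction b using Quotient.inductionOn with | _ b
    induction c using Quotient.inductionOn with | _ c
    induction x using Quotient.inductionOn with | _ x
    obtain ⟨A, hA⟩ := h.mk_mem_limInterval.1 h1
    obtain ⟨B, hB⟩ := h.mk_mem_limInterval.1 h2
    obtain ⟨C, hC⟩ := h.mk_mem_limInterval.1 h3
    rw [(h.isBornologous hμ).limMedian_mk]
    obtain ⟨D, hD⟩ := h.exists_dist_le (A + B + C + κ₀)
    refine CoarseLimit.mk_eq_iff.2 ⟨D, ?_⟩
    have hAle : A ≤ A + B + C + κ₀ := by rw [add_assoc, add_assoc]; exact le_self_add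
    have hBle : B ≤ A + B + C + κ₀ := by rw [add_comm A, add_assoc, add_assoc]; exact le_self_add
    have hCle : C ≤ A + B + C + κ₀ := by rw [add_comm _ C, add_assoc]; exact le_self_add
    have hκle : κ₀ ≤ A + B + C + κ₀ := le_add_self
    filter_upwards [hA, hB, hC] with t h1 h2 h3
    exact hD _ _ _ _ _ (nbhd_mono hAle _ h1) (nbhd_mono hBle _ h2) (nbhd_mono hCle _ h3)
      (nbhd_mono hκle _ (hμ _ _ _).1.1) (nbhd_mono hκle _ (hμ _ _ _).1.2)
      (nbhd_mono hκle _ (hμ _ _ _).2)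

/-- Localisation, symmetry and the four point condition are the exact identities of the limit
algebra, evaluated at the coordinate projections on the type of all tuples. -/
theorem isCoarseMedian {μ : X → X → X → X} (hμ : IsInducedMedian I κ₀ μ) : IsCoarseMedian μ where
  localisation_symmetry := by
    have hb := h.isBornologous hμ
    have loc := (h.isIntervalMedian hμ (⊤ : Filter (X × X))).self_left
      (CoarseLimit.mk ⊤ Prod.fst) (CoarseLimit.mk ⊤ Prod.snd)
    rw [hb.limMedian_mk] at loc
    obtain ⟨C, hC⟩ := exists_dist_le_of_mk_top_eq loc
    have sym : ∀ σ : Equiv.Perm (Fin 3), ∃ D : ℝ≥0, ∀ a : Fin 3 → X,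
        dist (μ (a (σ 0)) (a (σ 1)) (a (σ 2))) (μ (a 0) (a 1) (a 2)) ≤ D := by
      intro σ
      have := (h.isIntervalMedian hμ (⊤ : Filter (Fin 3 → X))).isMedianAlgebra.symmetry
        (fun i => CoarseLimit.mk ⊤ fun a => a i) σ
      rw [hb.limMedian_mk, hb.limMedian_mk] at this
      exact exists_dist_le_of_mk_top_eq this
    choose D hD using sym
    refine ⟨C + ∑ σ, D σ + 1, by positivity, fun a b => ?_, fun a σ => ?_⟩
    · refine (hC (a, b)).trans ?_
      rw [add_assoc]
      exact_mod_cast le_self_add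
    · refine (hD σ a).trans ?_
      have := Finset.single_le_sum (f := D) (fun _ _ => zero_le) (Finset.mem_univ σ)
      exact_mod_cast this.trans (le_add_self.trans le_self_add)
  bornologous := by
    obtain ⟨ρ, hρ, H⟩ := exists_monotone_bound (Q := fun R C => ∀ a a' b c : X, dist a a' ≤ R →
      dist (μ a b c) (μ a' b c) ≤ C)
      (fun R => by
        obtain ⟨C, hC⟩ := h.isBornologous hμ R
        exact ⟨C, fun a a' b c ha => hC _ _ _ _ _ _ ha (by simp) (by simp)⟩)
      (fun hR hC a a' b c ha => hC a a' b c (ha.trans (by exact_mod_cast hR)))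
      (fun hC hR a a' b c ha => (hR a a' b c ha).trans (by exact_mod_cast hC))
    exact ⟨ρ, hρ, fun a a' b c => H (nndist a a') a a' b c (by simp)⟩
  four_point := by
    have hb := h.isBornologous hμ
    have e := (h.isIntervalMedian hμ (⊤ : Filter (X × X × X × X))).median_assoc
      (CoarseLimit.mk ⊤ fun t => t.1) (CoarseLimit.mk ⊤ fun t => t.2.1)
      (CoarseLimit.mk ⊤ fun t => t.2.2.1) (CoarseLimit.mk ⊤ fun t => t.2.2.2)
    simp only [hb.limMedian_mk] at e
    obtain ⟨C, hC⟩ := exists_dist_le_of_mk_top_eq e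
    refine ⟨C + 1, by positivity, fun a b c d => (hC (a, b, c, d)).trans ?_⟩
    exact_mod_cast le_self_add

/-! ### Comparing an interval structure with the intervals of its median -/

/-- A point `x` near `I a b` is near all three intervals of the triple `a`, `x`, `b`, as is `μ a x
b`, so the two are close. -/
lemma nbhd_subset_nbhd_induced {μ : X → X → X → X} (hμ : IsInducedMedian I κ₀ μ) (R : ℝ≥0) :
    ∃ C : ℝ≥0, ∀ a b, nbhd R (I a b) ⊆ nbhd C (inducedInterval μ a b) := by
  obtain ⟨A, hA⟩ := h.left_mem
  obtain ⟨B, hB⟩ := h.right_mem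
  obtain ⟨D, hD⟩ := h.exists_dist_le (A + B + (R + (κ₀ + 1)))
  refine ⟨D, fun a b x hx => ⟨μ a x b, ⟨x, rfl⟩, ?_⟩⟩
  have l1 : A ≤ A + B + (R + (κ₀ + 1)) := by rw [add_assoc]; exact le_self_add
  have l2 : B ≤ A + B + (R + (κ₀ + 1)) := by rw [add_comm A, add_assoc]; exact le_self_add
  have l3 : R + (κ₀ + 1) ≤ A + B + (R + (κ₀ + 1)) := le_add_self
  have l4 : κ₀ ≤ A + B + (R + (κ₀ + 1)) :=
    le_self_add.trans (le_add_self.trans l3)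
  exact hD a x b _ _ (nbhd_mono l2 _ (hB a x)) (nbhd_mono l1 _ (hA x b))
    (nbhd_mono l3 _ (h.mem_nbhd_comm hx)) (nbhd_mono l4 _ (hμ a x b).1.1)
    (nbhd_mono l4 _ (hμ a x b).1.2) (nbhd_mono l4 _ (hμ a x b).2)

lemma nbhd_induced_subset_nbhd {μ : X → X → X → X} (hμ : IsInducedMedian I κ₀ μ) (R : ℝ≥0)
    (a b : X) : nbhd R (inducedInterval μ a b) ⊆ nbhd (R + (κ₀ + (κ₀ + 1))) (I a b) := by
  rintro x ⟨_, ⟨y, rfl⟩, hxy⟩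
  exact mem_nbhd_of_dist_le hxy (h.mem_nbhd_comm (hμ a y b).2)

end IsCoarseIntervalStructureWith

lemma intervalRankLE_iff_forall {I : X → X → Set X} {n : ℕ} : IntervalRankLE I n ↔
    ∀ R : ℝ≥0, ∃ C : ℝ≥0, ∀ (x : Fin (n + 1) → X) (q p : X),
      (∀ i j, i ≠ j → p ∈ nbhd R (I (x i) (x j))) → ∃ i, p ∈ nbhd C (I (x i) q) := by
  constructor
  · rintro ⟨ψ, -, hψ⟩ R
    -- The multi-median condition needs a positive parameter, while `R` may be `0`.
    refine ⟨ψ (R + 1), fun x q p hp => ?_⟩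
    have := @hψ (R + 1) (by positivity) x q p
      (by simpa using fun i j hij => nbhd_mono le_self_add _ (hp i j hij))
    simpa using this
  · intro H
    obtain ⟨ψ, hψ, hQ⟩ := exists_monotone_bound H
      (fun hR hC x q p hp => hC x q p fun i j hij => nbhd_mono hR _ (hp i j hij))
      (fun hC hR x q p hp => (hR x q p hp).imp fun i hi => nbhd_mono hC _ hi)
    refine ⟨ψ, hψ, fun R _ x q p hp => ?_⟩
    simpa using hQ R x q p (by simpa using hp)

/-- The rank only depends on the intervals up to uniformly bounded error. -/
lemma IntervalRankLE.of_nbhd_subset {I J : X → X → Set X} {n : ℕ}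
    (hJI : ∀ R, ∃ C, ∀ a b, nbhd R (J a b) ⊆ nbhd C (I a b))
    (hIJ : ∀ R, ∃ C, ∀ a b, nbhd R (I a b) ⊆ nbhd C (J a b)) (h : IntervalRankLE I n) :
    IntervalRankLE J n := by
  rw [intervalRankLE_iff_forall] at h ⊢
  intro R
  obtain ⟨S, hS⟩ := hJI R
  obtain ⟨C, hC⟩ := h S
  obtain ⟨D, hD⟩ := hIJ C
  exact ⟨D, fun x q p hp => (hC x q p fun i j hij => hS _ _ (hp i j hij)).imp fun i hi => hD _ _ hi⟩

lemma IsCoarseIntervalStructureWith.intervalRankLE_iff {I : X → X → Set X} {κ₀ : ℝ≥0}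
    (h : IsCoarseIntervalStructureWith I κ₀) {μ : X → X → X → X} (hμ : IsInducedMedian I κ₀ μ)
    (n : ℕ) : IntervalRankLE I n ↔ IntervalRankLE (inducedInterval μ) n :=
  ⟨.of_nbhd_subset (fun R => ⟨_, h.nbhd_induced_subset_nbhd hμ R⟩) (h.nbhd_subset_nbhd_induced hμ),
    .of_nbhd_subset (h.nbhd_subset_nbhd_induced hμ) fun R => ⟨_, h.nbhd_induced_subset_nbhd hμ R⟩⟩

/-! ### Comparison of the ranks -/

lemma _root_.Ultrafilter.exists_eventually {T ι : Type*} [Finite ι] (F : Ultrafilter T)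
    {p : ι → T → Prop} (h : ∀ᶠ t in F, ∃ i, p i t) : ∃ i, ∀ᶠ t in F, p i t := by
  by_contra! hc
  have h1 : ∀ i, ∀ᶠ t in (F : Filter T), ¬ p i t := hc
  obtain ⟨t, ht, i, hi⟩ := ((eventually_all.2 h1).and h).exists
  exact ht i hi

/-- A finite family of bounds can be replaced by a single bound. -/
lemma exists_uniform_bound {ι : Type*} [Finite ι] {Q : ι → ℝ≥0 → Prop} (hQ : ∀ i, ∃ C, Q i C)
    (hmono : ∀ {i C C'}, C ≤ C' → Q i C → Q i C') : ∃ C, ∀ i, Q i C := by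
  cases nonempty_fintype ι
  choose C hC using hQ
  exact ⟨∑ i, C i, fun i =>
    hmono (Finset.single_le_sum (f := C) (fun _ _ => zero_le) (Finset.mem_univ i)) (hC i)⟩

/-- In an embedded cube of dimension above `n`, the origin `p` lies between any two of its
neighbours `x i`. With `q` the opposite vertex, the multi-median condition would put `p` between
some `x i` and `q`, but the median of these three vertices is `x i`. -/
theorem IsCoarseMedian.medianAlgebraRankLE_limMedian {μ : X → X → X → X} (h : IsCoarseMedian μ)
    {n : ℕ} (hn : IntervalRankLE (inducedInterval μ) n) {T : Type*} (F : Ultrafilter T) :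
    MedianAlgebraRankLE (limMedian (F : Filter T) μ) n := by
  intro k f hinj hf
  by_contra! hk
  let δ : Fin (n + 1) → Fin k → Bool := fun i => Pi.single (Fin.castLE hk i) true
  let x : Fin (n + 1) → T → X := fun i => (f (δ i)).out
  let p : T → X := (f fun _ => false).out
  let q : T → X := (f fun _ => true).out
  have hx : ∀ i, CoarseLimit.mk F (x i) = f (δ i) := fun i => Quotient.out_eq _
  have hp : CoarseLimit.mk F p = f fun _ => false := Quotient.out_eq _
  have hq : CoarseLimit.mk F q = f fun _ => true := Quotient.out_eq _
  have hbetween : ∀ i j, ∃ C : ℝ≥0, i ≠ j →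
      ∀ᶠ t in (F : Filter T), p t ∈ nbhd C (inducedInterval μ (x i t) (x j t)) := by
    intro i j
    by_cases hij : i = j
    · exact ⟨0, fun h => absurd hij h⟩
    have e : cubeMedian k (δ i) (fun _ => false) (δ j) = fun _ => false := by
      ext l
      by_cases hl : l = Fin.castLE hk i
      · have : l ≠ Fin.castLE hk j := fun h' => hij (Fin.castLE_injective hk (hl.symm.trans h'))
        simp [cubeMedian, δ, this]
      · have : δ i l = false := by
          simp only [δ, Pi.single_eq_of_ne hl]; rfl
        simp [cubeMedian, this]
    have e' := hf (δ i) (fun _ => false) (δ j)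
    rw [e, ← hp, ← hx, ← hx, h.isBornologous.limMedian_mk] at e'
    obtain ⟨C, hC⟩ := CoarseLimit.mk_eq_iff.1 e'
    exact ⟨C, fun _ => hC.mono fun t ht => ⟨_, ⟨p t, rfl⟩, ht⟩⟩
  obtain ⟨R, hR⟩ := exists_uniform_bound
    (Q := fun (ij : Fin (n + 1) × Fin (n + 1)) C => ij.1 ≠ ij.2 →
      ∀ᶠ t in (F : Filter T), p t ∈ nbhd C (inducedInterval μ (x ij.1 t) (x ij.2 t)))
    (fun ij => hbetween ij.1 ij.2)
    (fun hC h hij => (h hij).mono fun t ht => nbhd_mono hC _ ht)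
  obtain ⟨C, hC⟩ := intervalRankLE_iff_forall.1 hn R
  have hev : ∀ᶠ t in (F : Filter T), ∃ i, p t ∈ nbhd C (inducedInterval μ (x i t) (q t)) := by
    have : ∀ᶠ t in (F : Filter T), ∀ ij : Fin (n + 1) × Fin (n + 1), ij.1 ≠ ij.2 →
        p t ∈ nbhd R (inducedInterval μ (x ij.1 t) (x ij.2 t)) :=
      eventually_all.2 fun ij => eventually_imp_distrib_left.2 (hR ij)
    exact this.mono fun t ht => hC _ _ _ fun i j hij => ht (i, j) hij
  -- The index depends on `t`; the ultrafilter selects one that works on a large set.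
  obtain ⟨i, hi⟩ := F.exists_eventually hev
  have e := h.limMedian_eq_of_mem_nbhd hi
  rw [hx, hp, hq, ← hf] at e
  have := congrFun (hinj e) (Fin.castLE hk i)
  simp [cubeMedian, δ] at this

/-- Finite median algebras may be replaced by isomorphic ones in `Type`. -/
lemma IsApproximable.of_finite {μ : X → X → X → X} {n : ℕ} {C : ℝ≥0} {A : Finset X} {P : Type*}
    [Finite P] {m : P → P → P → P} (hm : IsMedianAlgebra m) (hn : MedianAlgebraRankLE m n)
    (π : A → P) (l : P → X) (hl : ∀ x y z, dist (l (m x y z)) (μ (l x) (l y) (l z)) ≤ C)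
    (hπ : ∀ a : A, dist (a : X) (l (π a)) ≤ C) : IsApproximable μ n C A := by
  obtain ⟨N, ⟨e⟩⟩ := Finite.exists_equiv_fin P
  refine ⟨Fin N, inferInstance, fun x y z => e (m (e.symm x) (e.symm y) (e.symm z)),
    fun a => e (π a), fun x => l (e.symm x), ⟨fun a b => ?_, fun a σ => ?_, fun a b c d f => ?_⟩,
    fun k f hinj hf => ?_, fun x y z => ?_, fun a => ?_⟩
  · simp [hm.localisation]
  · exact congrArg e (hm.symmetry (fun i => e.symm (a i)) σ)
  · simp [← hm.five_point]
  · exact hn k (fun v => e.symm (f v)) (e.symm.injective.comp hinj) fun u v w => by simp [hf]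
  · simpa using hl _ _ _
  · simpa using hπ a

lemma IsApproximable.mono {μ : X → X → X → X} {n : ℕ} {C D : ℝ≥0} {A : Finset X} (hCD : C ≤ D)
    (h : IsApproximable μ n C A) : IsApproximable μ n D A := by
  obtain ⟨P, hP, m, π, l, h1, h2, h3, h4⟩ := h
  exact ⟨P, hP, m, π, l, h1, h2, fun x y z => (h3 x y z).trans (by exact_mod_cast hCD),
    fun a => (h4 a).trans (by exact_mod_cast hCD)⟩

theorem IsCoarseMedian.medianRankLE_of_limMedian {μ : X → X → X → X} (h : IsCoarseMedian μ) {n : ℕ}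
    (hn : MedianAlgebraRankLE (limMedian (hyperfilter ℕ : Filter ℕ) μ) n) : MedianRankLE μ n := by
  suffices H : ∀ p : ℕ, ∃ C : ℝ≥0, ∀ A : Finset X, A.Nonempty → A.card ≤ p →
      IsApproximable μ n C A by
    choose C hC using H
    exact ⟨C, hC⟩
  intro p
  by_contra! hc
  choose A hne hcard hA using fun N : ℕ => hc N
  have hsurj : ∀ N, ∃ g : Fin p → X, ∀ a ∈ A N, ∃ i, g i = a := by
    intro N
    have : Nonempty (A N) := (hne N).to_subtype
    obtain ⟨e⟩ := Function.Embedding.nonempty_of_card_le (α := A N) (β := Fin p)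
      (by simpa using hcard N)
    exact ⟨fun i => (Function.invFun e i : A N), fun a ha => ⟨e ⟨a, ha⟩, by
      exact congrArg Subtype.val (Function.leftInverse_invFun e.injective ⟨a, ha⟩)⟩⟩
  choose g hg using hsurj
  set F : Filter ℕ := (hyperfilter ℕ : Filter ℕ) with hF
  have hb := h.isBornologous
  have hmed := h.isMedianAlgebra F
  let a : Fin p → CoarseLimit F X := fun i => CoarseLimit.mk F fun N => g N i
  -- This finite subalgebra of the limit will approximate some `A N`, with `l` given by the `N`-th
  -- entries of representatives.
  let P := {x // MedianClosure (limMedian F μ) a x}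
  have : Finite P := hmed.finite_medianClosure a
  let m : P → P → P → P := fun x y z => ⟨limMedian F μ x y z, x.2.median y.2 z.2⟩
  have hm : IsMedianAlgebra m :=
    ⟨fun x y => Subtype.ext (hmed.localisation _ _),
      fun x σ => Subtype.ext (hmed.symmetry (fun i => x i) σ),
      fun x y z u v => Subtype.ext (hmed.five_point _ _ _ _ _)⟩
  have hrank : MedianAlgebraRankLE m n := fun k f hinj hf =>
    hn k (fun v => f v) (Subtype.val_injective.comp hinj)
      fun u v w => congrArg Subtype.val (hf u v w)
  obtain ⟨C, hC⟩ := exists_uniform_bound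
    (Q := fun (t : P × P × P) C => ∀ᶠ N in F,
      dist ((m t.1 t.2.1 t.2.2).1.out N) (μ (t.1.1.out N) (t.2.1.1.out N) (t.2.2.1.out N)) ≤ C)
    (fun t => CoarseLimit.mk_eq_iff.1 (by
      rw [← hb.limMedian_mk]
      simp only [CoarseLimit.mk, Quotient.out_eq]
      rfl))
    (fun hC h => h.mono fun N hN => hN.trans (by exact_mod_cast hC))
  obtain ⟨D, hD⟩ := exists_uniform_bound
    (Q := fun (i : Fin p) D => ∀ᶠ N in F, dist (g N i) ((a i).out N) ≤ D)
    (fun i => CoarseLimit.mk_eq_iff.1 (Quotient.out_eq _).symm)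
    (fun hC h => h.mono fun N hN => hN.trans (by exact_mod_cast hC))
  have hlarge : ∀ᶠ N : ℕ in F, C + D ≤ N := by
    have h1 : ∀ᶠ N : ℕ in atTop, C + D ≤ N := by
      filter_upwards [eventually_ge_atTop ⌈C + D⌉₊] with N hN
      exact Nat.ceil_le.1 hN
    exact h1.filter_mono Nat.hyperfilter_le_atTop
  -- Finitely many estimates hold simultaneously at some `N` exceeding their total error, whereas `A
  -- N` admits no approximation with error `N`.
  obtain ⟨N, hN, hCN, hDN⟩ :=
    (hlarge.and ((eventually_all.2 hC).and (eventually_all.2 hD))).exists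
  refine hA N (IsApproximable.mono hN ?_)
  choose i hi using fun x : A N => hg N x x.2
  refine IsApproximable.of_finite hm hrank (fun x => ⟨a (i x), .of _⟩) (fun x => x.1.out N)
    (fun x y z => (hCN (x, y, z)).trans ?_) fun x => ?_
  · exact_mod_cast le_self_add
  · rw [← hi x]
    exact (hDN (i x)).trans (by exact_mod_cast le_add_self)

theorem IsCoarseMedian.intervalRankLE_of_medianRankLE {μ : X → X → X → X} (h : IsCoarseMedian μ)
    {n : ℕ} (hn : MedianRankLE μ n) : IntervalRankLE (inducedInterval μ) n := by
  classical
  obtain ⟨c, hc⟩ := hn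
  rw [intervalRankLE_iff_forall]
  intro R
  by_contra! hcon
  choose x q p hp hnot using fun N : ℕ => hcon N
  -- The `n + 1` points `x N i` together with `p N` and `q N`: the error does not depend on `N`.
  have happrox : ∀ N, IsApproximable μ n (c (n + 3))
      (insert (p N) (insert (q N) (Finset.univ.image (x N)))) := fun N => by
    refine hc _ _ (Finset.insert_nonempty _ _) ?_
    have h1 := Finset.card_insert_le (p N) (insert (q N) (Finset.univ.image (x N)))
    have h2 := Finset.card_insert_le (q N) (Finset.univ.image (x N))
    have h3 := Finset.card_image_le (s := Finset.univ) (f := x N)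
    simp only [Finset.card_univ, Fintype.card_fin] at h3
    omega
  choose P _ m π l hm hrank hl hπ using happrox
  set F : Ultrafilter ℕ := hyperfilter ℕ with hF
  have hb := h.isBornologous
  have hY := h.isIntervalMedian (F : Filter ℕ)
  let mM : (∀ N, P N) → (∀ N, P N) → (∀ N, P N) → ∀ N, P N :=
    fun x y z N => m N (x N) (y N) (z N)
  have hM : IsMedianAlgebra mM :=
    ⟨fun x y => funext fun N => (hm N).localisation _ _,
      fun x σ => funext fun N => (hm N).symmetry (fun i => x i N) σ,
      fun x y z u v => funext fun N => (hm N).five_point _ _ _ _ _⟩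
  have hI := hM.isIntervalMedian
  let L : (∀ N, P N) → CoarseLimit (F : Filter ℕ) X :=
    fun y => CoarseLimit.mk F fun N => l N (y N)
  have hL : ∀ x y z, L (mM x y z) = limMedian (F : Filter ℕ) μ (L x) (L y) (L z) := fun x y z => by
    rw [hb.limMedian_mk]
    exact CoarseLimit.mk_eq_iff.2 ⟨_, .of_forall fun N => hl N _ _ _⟩
  have hpoint : ∀ (y : ℕ → X) (hy : ∀ N, y N ∈ insert (p N) (insert (q N)
      (Finset.univ.image (x N)))), L (fun N => π N ⟨y N, hy N⟩) = CoarseLimit.mk F y :=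
    fun y hy => (CoarseLimit.mk_eq_iff.2 ⟨_, .of_forall fun N => hπ N ⟨y N, hy N⟩⟩).symm
  let p₀ : ∀ N, P N := fun N => π N ⟨p N, by simp⟩
  let q₀ : ∀ N, P N := fun N => π N ⟨q N, by simp⟩
  let x₀ : Fin (n + 1) → ∀ N, P N := fun i N => π N ⟨x N i, by simp⟩
  have hp₀ : L p₀ = CoarseLimit.mk F p := hpoint p _
  have hq₀ : L q₀ = CoarseLimit.mk F q := hpoint q _
  have hx₀ : ∀ i, L (x₀ i) = CoarseLimit.mk F fun N => x N i := fun i => hpoint (fun N => x N i) _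
  have hbetween : ∀ i j, i ≠ j →
      limMedian (F : Filter ℕ) μ (L p₀) (L (x₀ i)) (L (x₀ j)) = L p₀ := by
    intro i j hij
    rw [hY.swap, hp₀, hx₀, hx₀]
    exact h.limMedian_eq_of_mem_nbhd (.of_forall fun N => hp N i j hij)
  let _ := hM.distribLattice p₀ q₀
  let _ : OrderBot {y // mM p₀ y q₀ = y} :=
    { bot := ⟨p₀, hM.localisation _ _⟩
      bot_le := fun y => hM.localisation _ _ }
  let e : Fin (n + 1) → {y // mM p₀ y q₀ = y} := fun i => ⟨mM p₀ (x₀ i) q₀, hI.mem₃ _ _ _⟩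
  -- The meets `e i ⊓ e j` equal `p₀` only after applying `L`. Raising the origin to their join `r`
  -- gives an exact cube without changing its image under `L`.
  let r : {y // mM p₀ y q₀ = y} :=
    Finset.univ.sup fun ij : Fin (n + 1) × Fin (n + 1) => if ij.1 = ij.2 then ⊥ else e ij.1 ⊓ e ij.2
  have her : ∀ i j, i ≠ j → e i ⊓ e j ≤ r := fun i j hij => by
    have := Finset.le_sup (f := fun ij : Fin (n + 1) × Fin (n + 1) =>
      if ij.1 = ij.2 then ⊥ else e ij.1 ⊓ e ij.2) (Finset.mem_univ (i, j))
    simpa only [hij, if_false] using this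
  have hLr : L r.1 = L p₀ := by
    refine Finset.sup_induction (p := fun y : {y // mM p₀ y q₀ = y} => L y.1 = L p₀) rfl ?_ ?_
    · intro y hy z hz
      refine (hL q₀ y.1 z.1).trans ?_
      rw [hy, hz, hY.rot, hY.self_left]
    · intro ij _
      by_cases hij : ij.1 = ij.2
      · simp only [hij, if_true]; rfl
      · simp only [hij, if_false]
        refine (hL p₀ (e ij.1).1 (e ij.2).1).trans ?_
        have h1 : ∀ i, L (e i).1 = limMedian (F : Filter ℕ) μ (L p₀) (L (x₀ i)) (L q₀) :=
          fun i => hL p₀ (x₀ i) q₀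
        rw [h1, h1]
        -- Seen from `L p₀`, the image of the meet is below both `L (x₀ ij.1)` and `L (x₀ ij.2)`,
        -- hence below their median with `L p₀`, which is `L p₀` itself.
        have h2 := hY.mem_median
          (hY.trans (hY.mem₁ (L p₀) (L (x₀ ij.1)) (L q₀)) (hY.mem₁ _ _
            (limMedian (F : Filter ℕ) μ (L p₀) (L (x₀ ij.2)) (L q₀))))
          (hY.trans (hY.mem₁ (L p₀) (L (x₀ ij.2)) (L q₀)) (hY.mem₃ _
            (limMedian (F : Filter ℕ) μ (L p₀) (L (x₀ ij.1)) (L q₀)) _))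
        rw [hbetween _ _ hij] at h2
        exact hY.eq_of_mem_self h2
  have hcube : ∀ u v w, (cubeMap r e (cubeMedian (n + 1) u v w)).1 =
      mM (cubeMap r e u).1 (cubeMap r e v).1 (cubeMap r e w).1 := by
    intro u v w
    refine Eq.trans ?_ (hM.median_eq_sup p₀ q₀ _ _ _).symm
    have e1 := cubeMap_or (r := r) (e := e) (fun i => (u i && v i) || (v i && w i))
      fun i => w i && u i
    have e2 := cubeMap_or (r := r) (e := e) (fun i => u i && v i) fun i => v i && w i
    rw [e2, cubeMap_and her, cubeMap_and her, cubeMap_and her] at e1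
    exact congrArg Subtype.val e1
  -- Each factor has rank at most `n`, so no projection of the `(n + 1)`-cube is injective.
  have hcollapse : ∀ N, ∃ i, (cubeMap r e (Pi.single i true)).1 N =
      (cubeMap r e fun _ => false).1 N := fun N =>
    exists_eq_of_not_injective (m := m N) (f := fun v => (cubeMap r e v).1 N)
      (fun u v w => congrFun (hcube u v w) N)
      (fun hinj => by
        have := hrank N _ _ hinj fun u v w => congrFun (hcube u v w) N
        omega)
  obtain ⟨i, hi⟩ := F.exists_eventually (.of_forall hcollapse)
  rw [cubeMap_false, cubeMap_single] at hi
  have hLi : L (r ⊔ e i).1 = L r.1 :=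
    CoarseLimit.mk_eq_iff.2 ⟨0, hi.mono fun N hN => by rw [hN]; simp⟩
  have hLe : L (r ⊔ e i).1 = limMedian (F : Filter ℕ) μ (L q₀) (L r.1) (L (e i).1) := hL q₀ r.1 (e i).1
  have hei : limMedian (F : Filter ℕ) μ (L q₀) (L p₀) (L (e i).1) = L (e i).1 := by
    rw [hY.rot]
    exact (hL _ _ _).symm.trans (congrArg L (e i).2)
  -- The collapsed edge forces `L (e i) = L p₀`: in the limit, `p` is the median of `p`, `x i` and
  -- `q`, contrary to the choice of the configurations.
  rw [hLi, hLr, hei] at hLe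
  have hfin : L p₀ = limMedian (F : Filter ℕ) μ (L p₀) (L (x₀ i)) (L q₀) := hLe.trans (hL _ _ _)
  rw [hY.swap, hp₀, hq₀, hx₀, hb.limMedian_mk] at hfin
  obtain ⟨C, hC⟩ := CoarseLimit.mk_eq_iff.1 hfin
  have hlarge : ∀ᶠ N : ℕ in (F : Filter ℕ), C ≤ N := by
    have h1 : ∀ᶠ N : ℕ in atTop, C ≤ N := by
      filter_upwards [eventually_ge_atTop ⌈C⌉₊] with N hN
      exact Nat.ceil_le.1 hN
    exact h1.filter_mono Nat.hyperfilter_le_atTop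
  obtain ⟨N, hCN, hN⟩ := (hC.and hlarge).exists
  exact hnot N i (nbhd_mono hN _ ⟨_, ⟨p N, rfl⟩, hCN⟩)

theorem IsCoarseMedian.medianRankLE_iff {μ : X → X → X → X} (h : IsCoarseMedian μ) (n : ℕ) :
    MedianRankLE μ n ↔ IntervalRankLE (inducedInterval μ) n :=
  ⟨h.intervalRankLE_of_medianRankLE,
    fun hn => h.medianRankLE_of_limMedian (h.medianAlgebraRankLE_limMedian hn _)⟩

lemma rankEq_iff {μ : X → X → X → X} {I : X → X → Set X}
    (h : ∀ n, MedianRankLE μ n ↔ IntervalRankLE I n) (n : ℕ) :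
    MedianRankEq μ n ↔ IntervalRankEq I n := by
  simp only [MedianRankEq, IntervalRankEq, h]

end CoarseMedian

theorem corollary4p6 {X : Type*} [MetricSpace X] :
    (∀ μ : X → X → X → X, CoarseMedian.IsCoarseMedian μ →
      CoarseMedian.IsCoarseIntervalStructure (CoarseMedian.inducedInterval μ) ∧
      ∀ n : ℕ,
        (CoarseMedian.MedianRankLE μ n ↔
          CoarseMedian.IntervalRankLE (CoarseMedian.inducedInterval μ) n) ∧
        (CoarseMedian.MedianRankEq μ n ↔
          CoarseMedian.IntervalRankEq (CoarseMedian.inducedInterval μ) n)) ∧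
    (∀ (I : X → X → Set X) (κ₀ : NNReal), CoarseMedian.IsCoarseIntervalStructureWith I κ₀ →
      (∃ μ : X → X → X → X, CoarseMedian.IsInducedMedian I κ₀ μ) ∧
      ∀ μ : X → X → X → X, CoarseMedian.IsInducedMedian I κ₀ μ →
        CoarseMedian.IsCoarseMedian μ ∧
        ∀ n : ℕ,
          (CoarseMedian.IntervalRankLE I n ↔ CoarseMedian.MedianRankLE μ n) ∧
          (CoarseMedian.IntervalRankEq I n ↔ CoarseMedian.MedianRankEq μ n)) := by
  refine ⟨fun μ hμ => ⟨hμ.isCoarseIntervalStructure, fun n =>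
    ⟨hμ.medianRankLE_iff n, CoarseMedian.rankEq_iff hμ.medianRankLE_iff n⟩⟩, fun I κ₀ hI => ⟨?_, ?_⟩⟩
  · choose μ hμ using hI.nonempty_inter
    exact ⟨μ, hμ⟩
  · intro μ hμ
    have hc := hI.isCoarseMedian hμ
    have hr : ∀ n, CoarseMedian.MedianRankLE μ n ↔ CoarseMedian.IntervalRankLE I n := fun n =>
      (hc.medianRankLE_iff n).trans (hI.intervalRankLE_iff hμ n).symm
    exact ⟨hc, fun n => ⟨(hr n).symm, (CoarseMedian.rankEq_iff hr n).symm⟩⟩
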